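/- Let $K\ge 2$ be an integer. Let $X$ be a real random variable with Lebesgue density $f$ and characteristic function $\phi_X(u)=\mathbb{E}[e^{iuX}]$, and suppose that only $n$ independent copies $Y_1,\dots,Y_n$ of $Y=X_1+\dots+X_K$ are observed, where $X_1,\dots,X_K$ are independent copies of $X$. For $b\ge\beta>1$ and positive constants $C,C',C_X,C_f,u_0$ let $\mathcal{F}(\beta,b)=\mathcal{F}(\beta,b,C,C',C_X,C_f,u_0)$ be the class of all probability densities $f$ with $$(1+C|u|)^{-b}\le|\phi_X(u)|\ \text{ for all } u\in\mathbb{R},\qquad |\phi_X(u)|\le(1+C'|u|)^{-\beta}\ \text{ for all } |u|\ge u_0,$$ $$\mathbb{E}[X^2]\le C_X,\qquad \|f\|_{L^2(\mathbb{R})}\le C_f .$$ **Theorem.** Let $b\ge\beta>1$. There is $\kappa>0$, depending only on $\beta$ and $b$, such that the following holds for all $C_X,C_f>0$ with $C_XC_f^4\ge\kappa$ and all $u_0>0$. There are $C_0,C_0'>0$, depending only on $\beta,b,C_X,C_f,u_0$, such that for all $C\ge C_0$, all $0<C'\le C_0'$ and every integer $K\ge2$ there is a constant $d>0$ (not depending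 on $n$) with $$\liminf_{n\to\infty}\ \inf_{\tilde f}\ \sup_{f\in\mathcal{F}(\beta,b)}\mathbb{E}_f\big[\|f-\tilde f\|_{L^2(\mathbb{R})}^2\big]\;n^{\frac{2\beta-1}{2bK}}\ \ge\ d,$$ where the infimum is over all estimators $\tilde f$ of $f$ based on $Y_1,\dots,Y_n$. -/

import Mathlib

open MeasureTheory Filter
open scoped ENNReal

noncomputable section

namespace GroupedData

/-- The measure on `ℝ` with Lebesgue density `f` (the law of one variable `X`). -/
def law (f : ℝ → ℝ) : Measure ℝ :=
  volume.withDensity (fun x => ENNReal.ofReal (f x))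

/-- `f` is a probability density with respect to Lebesgue measure. -/
structure IsDensity (f : ℝ → ℝ) : Prop where
  measurable : Measurable f
  nonneg : ∀ x, 0 ≤ f x
  mass_one : ∫⁻ x, ENNReal.ofReal (f x) = 1

/-- The law of one aggregated observation `Y = X₁ + ⋯ + X_K`, where `X₁, …, X_K` are independent
with density `f`. -/
def aggregatedLaw (K : ℕ) (f : ℝ → ℝ) : Measure ℝ :=
  (Measure.pi (fun _ : Fin K => law f)).map (fun x => ∑ k, x k)

/-- The joint law of the `n` independent aggregated observations `Y₁, …, Y_n`. -/
def sampleLaw (K n : ℕ) (f : ℝ → ℝ) : Measure (Fin n → ℝ) :=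
  Measure.pi (fun _ : Fin n => aggregatedLaw K f)

/-- The class of densities `f` with `‖f‖_{L²} ≤ Cf` and `E[X²] ≤ CX`, whose characteristic function
satisfies `(1 + C|u|)^(-b) ≤ |φ(u)|` for all `u` and `|φ(u)| ≤ (1 + C'|u|)^(-β)` for `|u| ≥ u₀`. -/
structure InClass (β b C C' CX Cf u₀ : ℝ) (f : ℝ → ℝ) : Prop where
  density : IsDensity f
  lower : ∀ u : ℝ, (1 + C * |u|) ^ (-b) ≤ ‖charFun (law f) u‖
  upper : ∀ u : ℝ, u₀ ≤ |u| → ‖charFun (law f) u‖ ≤ (1 + C' * |u|) ^ (-β)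
  second_moment : ∫⁻ x, ENNReal.ofReal (x ^ 2) ∂(law f) ≤ ENNReal.ofReal CX
  l2_norm : eLpNorm f 2 volume ≤ ENNReal.ofReal Cf

/-- An estimator of a function on `ℝ`, based on `n` real observations: a jointly measurable map
`(y, x) ↦ est y x`, where `y` is the sample and `x` the argument of the estimated function. -/
structure Estimator (n : ℕ) where
  est : (Fin n → ℝ) → ℝ → ℝ
  measurable_est : Measurable (Function.uncurry est)

/-- The mean integrated squared error `E_f ‖f - f̃‖²` of the estimator `f̃`, in `[0, ∞]`. -/
def mise (K n : ℕ) (f : ℝ → ℝ) (g : Estimator n) : ℝ≥0∞ :=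
  ∫⁻ y, (∫⁻ x, ENNReal.ofReal ((f x - g.est y x) ^ 2) ∂(volume : Measure ℝ)) ∂(sampleLaw K n f)

/-- The minimax risk: infimum over all estimators of the supremum of the mean integrated squared
error over the class. -/
def minimaxRisk (K n : ℕ) (β b C C' CX Cf u₀ : ℝ) : ℝ≥0∞ :=
  ⨅ g : Estimator n, ⨆ f : {f : ℝ → ℝ // InClass β b C C' CX Cf u₀ f}, mise K n f.1 g

end GroupedData

end

noncomputable section

namespace GroupedData

open Complex FourierTransform

/-! The bound rests on the ambiguity of the `K`-th root. The law of `Y` determines only `φ_X ^ K`.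
Where `φ_X` has no zeros, continuity and `φ_X 0 = 1` fix the branch, but where `φ_X` is as small as
the class permits, the data can hardly tell whether the branch has changed.

Two hypotheses are compared. Both have the characteristic function `spec`, a compactly supported
part `baseChar` plus a small multiple of the slowly decaying `carrier`, which is of size `|ξ| ^
(-β)`. Near `|ξ| = m` the factor `dip` lowers the carrier to order `m ^ (-b)`, the least size
allowed. Inside this dip the factor `twist` of the second hypothesis turns the phase by `2π/K` and
keeps it turned for all larger frequencies; the first hypothesis has no twist.

The `K`-th powers agree except inside the dip, because the total turn becomes `2π`. There they
differ by `O(m ^ (-bK))` (`spec_pow_sub_spec_pow`, `exists_symbolBound_spec_pow_sub`). This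
difference is a `C⁴` bump, so its Fourier transform decays like `tail`; the densities of the sums
are bounded below by multiples of `tail`. The likelihood ratio of one observation is therefore `1 +
O(m ^ (-bK))` uniformly (`exists_aggregatedLaw_close`), and `m = n ^ (1/(2bK))` keeps the likelihood
ratio of `n` observations bounded in `L²`. Beyond `m` the two characteristic functions differ by a
fixed fraction of `|ξ| ^ (-β)`, so by Plancherel the squared `L²` distance is at least of order `m ^
(1 - 2β)` (`exists_separation`). Le Cam's method (`two_point_bound`, `le_minimaxRisk`) turns this
into the rate.

Membership in the class (`exists_inClass`) must be uniform in `m`. A dilation by `t` serves the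
moment and `L²` constraints, and only the product `C_X C_f⁴` is invariant under dilations, which is
where `κ` comes from. -/

/-- `w` is of class `C⁴`, and its derivatives of order at most four are bounded by `A * ω`. -/
structure SymbolBound (ω : ℝ → ℝ) (A : ℝ) (w : ℝ → ℂ) : Prop where
  contDiff : ContDiff ℝ 4 w
  bound : ∀ k ≤ 4, ∀ x, ‖iteratedDeriv k w x‖ ≤ A * ω x

/-! ### Calculus of `C⁴` functions with weighted derivative bounds. -/

namespace SymbolBound

variable {ω ω₁ ω₂ : ℝ → ℝ} {A A₁ A₂ : ℝ} {w w₁ w₂ : ℝ → ℂ}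

lemma norm_le (h : SymbolBound ω A w) (x : ℝ) : ‖w x‖ ≤ A * ω x := by
  simpa using h.bound 0 (by norm_num) x

lemma mono (h : SymbolBound ω₁ A₁ w) (hle : ∀ x, A₁ * ω₁ x ≤ A₂ * ω₂ x) :
    SymbolBound ω₂ A₂ w :=
  ⟨h.contDiff, fun k hk x => (h.bound k hk x).trans (hle x)⟩

lemma add (h₁ : SymbolBound ω A₁ w₁) (h₂ : SymbolBound ω A₂ w₂) :
    SymbolBound ω (A₁ + A₂) (fun x => w₁ x + w₂ x) := by
  refine ⟨h₁.contDiff.add h₂.contDiff, fun k hk x => ?_⟩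
  have hk' : (k : WithTop ℕ∞) ≤ 4 := by exact_mod_cast hk
  have := iteratedDeriv_add (x := x) (n := k) (h₁.contDiff.of_le hk').contDiffAt
    (h₂.contDiff.of_le hk').contDiffAt
  have e : iteratedDeriv k (fun x => w₁ x + w₂ x) x = _ := this
  rw [e, add_mul]
  exact (norm_add_le _ _).trans (add_le_add (h₁.bound k hk x) (h₂.bound k hk x))

lemma const_mul (h : SymbolBound ω A w) (c : ℂ) :
    SymbolBound ω (‖c‖ * A) (fun x => c * w x) := by
  refine ⟨contDiff_const.mul h.contDiff, fun k hk x => ?_⟩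
  rw [iteratedDeriv_const_mul_field, norm_mul, mul_assoc]
  exact mul_le_mul_of_nonneg_left (h.bound k hk x) (norm_nonneg _)

lemma const (c : ℂ) : SymbolBound (fun _ => 1) ‖c‖ (fun _ => c) := by
  refine ⟨contDiff_const, fun k _ x => ?_⟩
  rw [iteratedDeriv_const]
  split_ifs <;> simp

lemma sub (h₁ : SymbolBound ω A₁ w₁) (h₂ : SymbolBound ω A₂ w₂) :
    SymbolBound ω (A₁ + A₂) (fun x => w₁ x - w₂ x) := by
  have := h₁.add (h₂.const_mul (-1))
  simpa [sub_eq_add_neg] using this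

lemma comp_sub_const (h : SymbolBound ω A w) (m : ℝ) :
    SymbolBound (fun x => ω (x - m)) A (fun x => w (x - m)) := by
  refine ⟨h.contDiff.comp (contDiff_id.sub contDiff_const), fun k hk x => ?_⟩
  rw [iteratedDeriv_comp_sub_const]
  exact h.bound k hk _

lemma comp_neg (h : SymbolBound ω A w) :
    SymbolBound (fun x => ω (-x)) A (fun x => w (-x)) := by
  refine ⟨h.contDiff.comp contDiff_neg, fun k hk x => ?_⟩
  rw [iteratedDeriv_comp_neg, norm_smul]
  simpa using h.bound k hk _

lemma mul (h₁ : SymbolBound ω₁ A₁ w₁) (h₂ : SymbolBound ω₂ A₂ w₂) :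
    SymbolBound (fun x => ω₁ x * ω₂ x) (16 * A₁ * A₂) (fun x => w₁ x * w₂ x) := by
  refine ⟨h₁.contDiff.mul h₂.contDiff, fun k hk x => ?_⟩
  have hk' : (k : WithTop ℕ∞) ≤ 4 := by exact_mod_cast hk
  have e : iteratedDeriv k (fun x => w₁ x * w₂ x) x = _ :=
    iteratedDeriv_mul (x := x) (n := k) (h₁.contDiff.of_le hk').contDiffAt
      (h₂.contDiff.of_le hk').contDiffAt
  have n₁ : 0 ≤ A₁ * ω₁ x := (norm_nonneg _).trans (h₁.norm_le x)
  have n₂ : 0 ≤ A₂ * ω₂ x := (norm_nonneg _).trans (h₂.norm_le x)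
  rw [e]
  calc _ ≤ ∑ i ∈ Finset.range (k + 1), (k.choose i : ℝ) * ((A₁ * ω₁ x) * (A₂ * ω₂ x)) := by
        refine (norm_sum_le _ _).trans (Finset.sum_le_sum fun i hi => ?_)
        have hi' : i ≤ k := by simpa [Nat.lt_succ_iff] using hi
        rw [norm_mul, norm_mul, mul_assoc]
        refine mul_le_mul (by simp) ?_ (by positivity) (by positivity)
        exact mul_le_mul (h₁.bound i (hi'.trans hk) x) (h₂.bound _ (by omega) x)
          (norm_nonneg _) n₁
    _ = 2 ^ k * ((A₁ * ω₁ x) * (A₂ * ω₂ x)) := by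
        rw [← Finset.sum_mul]
        congr 1
        exact_mod_cast Nat.sum_range_choose k
    -- The binomial coefficients of the Leibniz rule add up to `2 ^ k`, and `k ≤ 4`.
    _ ≤ 16 * ((A₁ * ω₁ x) * (A₂ * ω₂ x)) := by
        refine mul_le_mul_of_nonneg_right ?_ (mul_nonneg n₁ n₂)
        calc (2 : ℝ) ^ k ≤ 2 ^ 4 := pow_le_pow_right₀ (by norm_num) hk
          _ = 16 := by norm_num
    _ = _ := by ring

lemma pow (h : SymbolBound ω A w) (K : ℕ) :
    SymbolBound (fun x => ω x ^ K) ((16 * A) ^ K) (fun x => w x ^ K) := by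
  induction K with
  | zero => simpa using const 1
  | succ K ih =>
    have := ih.mul h
    simp only [← pow_succ] at this
    refine this.mono fun x => le_of_eq ?_
    ring

lemma integrable_iteratedDeriv (h : SymbolBound ω A w) (hω : Integrable ω) {k : ℕ} (hk : k ≤ 4) :
    Integrable (iteratedDeriv k w) := by
  refine Integrable.mono' (hω.const_mul A) ?_ (ae_of_all _ (h.bound k hk))
  exact (h.contDiff.continuous_iteratedDeriv k (by exact_mod_cast hk)).aestronglyMeasurable

lemma integrable (h : SymbolBound ω A w) (hω : Integrable ω) : Integrable w := by
  simpa using h.integrable_iteratedDeriv hω (k := 0) (by norm_num)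

lemma integral_norm_le (h : SymbolBound ω A w) (hω : Integrable ω) {k : ℕ} (hk : k ≤ 4) :
    ∫ x, ‖iteratedDeriv k w x‖ ≤ A * ∫ x, ω x := by
  rw [← integral_const_mul]
  exact integral_mono (h.integrable_iteratedDeriv hω hk).norm (hω.const_mul A) (h.bound k hk)

end SymbolBound

/-! ### The reference tail, Fourier decay and Plancherel. -/

/-- The tail function `(1 + x²)⁻²`. -/
def tail (x : ℝ) : ℝ := ((1 + x ^ 2) ^ 2)⁻¹

lemma tail_pos (x : ℝ) : 0 < tail x := by unfold tail; positivity

lemma tail_le_one (x : ℝ) : tail x ≤ 1 := by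
  unfold tail
  refine inv_le_one_of_one_le₀ ?_
  nlinarith [sq_nonneg x, sq_nonneg (x ^ 2)]

lemma continuous_tail : Continuous tail := by
  unfold tail
  refine Continuous.inv₀ (by fun_prop) fun x => by positivity

lemma tail_le_inv (x : ℝ) : tail x ≤ (1 + x ^ 2)⁻¹ := by
  unfold tail
  refine inv_anti₀ (by positivity) ?_
  nlinarith [sq_nonneg x, sq_nonneg (x ^ 2)]

lemma integrable_tail : Integrable tail :=
  Integrable.mono' integrable_inv_one_add_sq continuous_tail.aestronglyMeasurable
    (ae_of_all _ fun x => by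
      rw [Real.norm_of_nonneg (tail_pos x).le]; exact tail_le_inv x)

lemma integrable_sq_mul_tail : Integrable (fun x => x ^ 2 * tail x) := by
  refine Integrable.mono' integrable_inv_one_add_sq
    ((continuous_id.pow 2).mul continuous_tail).aestronglyMeasurable
    (ae_of_all _ fun x => ?_)
  have h : 0 < 1 + x ^ 2 := by positivity
  rw [Real.norm_of_nonneg (mul_nonneg (sq_nonneg x) (tail_pos x).le)]
  unfold tail
  rw [← div_eq_mul_inv, div_le_iff₀ (by positivity)]
  have : (1 + x ^ 2)⁻¹ * (1 + x ^ 2) ^ 2 = 1 + x ^ 2 := by field_simp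
  linarith

lemma integrable_tail_sq : Integrable fun x => tail x ^ 2 :=
  integrable_tail.mono' (continuous_tail.pow 2).aestronglyMeasurable (ae_of_all _ fun x => by
    rw [Real.norm_of_nonneg (sq_nonneg _)]
    nlinarith [tail_pos x, tail_le_one x])

/-- A Peetre-type inequality. It makes translates of `tail` comparable, and it gives the lower bound
`tail (x - y) ≥ tail x * tail y / 4` inside convolutions. -/
lemma tail_mul_le (x y : ℝ) : tail x * tail y ≤ 4 * tail (x - y) := by
  unfold tail
  rw [← mul_inv, ← div_eq_mul_inv, inv_eq_one_div, div_le_div_iff₀ (by positivity) (by positivity),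
    one_mul]
  have h : 1 + (x - y) ^ 2 ≤ 2 * ((1 + x ^ 2) * (1 + y ^ 2)) := by
    nlinarith [sq_nonneg (x + y), sq_nonneg (x * y), sq_nonneg x, sq_nonneg y]
  calc (1 + (x - y) ^ 2) ^ 2 ≤ (2 * ((1 + x ^ 2) * (1 + y ^ 2))) ^ 2 :=
        pow_le_pow_left₀ (by positivity) h 2
    _ = _ := by ring

/-- The Fourier transform of a symbol with integrable weight decays as `(1 + x²)⁻²`. -/
lemma SymbolBound.norm_fourier_le {ω : ℝ → ℝ} {A : ℝ} {w : ℝ → ℂ} (h : SymbolBound ω A w)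
    (hω : Integrable ω) (x : ℝ) : ‖𝓕 w x‖ ≤ 4 * A * (∫ y, ω y) * tail x := by
  set S := A * ∫ y, ω y with hS
  have key : ∀ k ≤ 4, |2 * Real.pi * x| ^ k * ‖𝓕 w x‖ ≤ S := by
    intro k hk
    have e := congrFun (Real.fourier_iteratedDeriv (N := 4) (n := k) h.contDiff
      (fun n hn => h.integrable_iteratedDeriv hω (by exact_mod_cast hn)) (by exact_mod_cast hk)) x
    have n : ‖𝓕 (iteratedDeriv k w) x‖ = |2 * Real.pi * x| ^ k * ‖𝓕 w x‖ := by
      rw [e, smul_eq_mul, norm_mul, norm_pow]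
      simp [abs_mul]
    rw [← n]
    refine le_trans ?_ (h.integral_norm_le hω hk)
    rw [Real.fourier_eq]
    refine (norm_integral_le_integral_norm _).trans_eq ?_
    simp
  have h0 := key 0 (by norm_num)
  have h4 := key 4 le_rfl
  have hx : x ^ 4 ≤ |2 * Real.pi * x| ^ 4 := by
    have : |x| ≤ |2 * Real.pi * x| := by
      rw [abs_mul, abs_of_pos (by positivity : 0 < 2 * Real.pi)]
      nlinarith [abs_nonneg x, Real.pi_gt_three]
    calc x ^ 4 = |x| ^ 4 := by rw [Even.pow_abs ⟨2, rfl⟩]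
      _ ≤ _ := pow_le_pow_left₀ (abs_nonneg _) this 4
  have hF := norm_nonneg (𝓕 w x)
  rw [show 4 * A * (∫ y, ω y) = 4 * S by rw [hS]; ring, tail, ← div_eq_mul_inv,
    le_div_iff₀ (by positivity)]
  have h1 : x ^ 4 * ‖𝓕 w x‖ ≤ S := (mul_le_mul_of_nonneg_right hx hF).trans h4
  -- Only the derivatives of order `0` and `4` are needed; each contributes `2 * S`, whence the
  -- factor `4`.
  have h2 : (1 + x ^ 2) ^ 2 ≤ 2 + 2 * x ^ 4 := by nlinarith [sq_nonneg (x ^ 2 - 1)]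
  calc ‖𝓕 w x‖ * (1 + x ^ 2) ^ 2 ≤ ‖𝓕 w x‖ * (2 + 2 * x ^ 4) := by gcongr
    _ ≤ 4 * S := by nlinarith

lemma continuous_fourier {w : ℝ → ℂ} (h : Integrable w) : Continuous (𝓕 w) := by
  exact VectorFourier.fourierIntegral_continuous Real.continuous_fourierChar
    (by exact continuous_inner) h

lemma SymbolBound.integrable_fourier {ω : ℝ → ℝ} {A : ℝ} {w : ℝ → ℂ} (h : SymbolBound ω A w)
    (hω : Integrable ω) : Integrable (𝓕 w) :=
  Integrable.mono' (integrable_tail.const_mul _)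
    (continuous_fourier (h.integrable hω)).aestronglyMeasurable
    (ae_of_all _ (h.norm_fourier_le hω))

/-- **Plancherel's theorem** for a continuous integrable function with integrable Fourier
transform. -/
lemma integral_norm_sq_fourier {w : ℝ → ℂ} (hc : Continuous w) (hi : Integrable w)
    (hF : Integrable (𝓕 w)) : ∫ x, ‖𝓕 w x‖ ^ 2 = ∫ x, ‖w x‖ ^ 2 := by
  have e := VectorFourier.integral_sesq_fourierIntegral_eq_neg_flip (innerSL ℂ (E := ℂ))
    (L := innerₗ ℝ) (μ := volume) (ν := volume) Real.continuous_fourierChar continuous_inner hi hF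
  have inv : VectorFourier.fourierIntegral Real.fourierChar volume (-(innerₗ ℝ).flip) (𝓕 w) = w := by
    have : -(innerₗ ℝ).flip = -(innerₗ ℝ) := by ext; simp
    rw [this]
    exact hc.fourierInv_fourier_eq hi hF
  rw [inv] at e
  apply Complex.ofReal_injective
  rw [← integral_complex_ofReal, ← integral_complex_ofReal]
  have hinner : ∀ z : ℂ, inner ℂ z z = ((‖z‖ ^ 2 : ℝ) : ℂ) := fun z => by
    rw [inner_self_eq_norm_sq_to_K]; simp
  change ∫ x, inner ℂ (𝓕 w x) (𝓕 w x) = ∫ x, inner ℂ (w x) (w x) at e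
  simpa only [hinner] using e

/-! ### The triangle function, its convolution square, and their Fourier transforms. -/

/-- The triangle function `max (1 - |x|) 0`. -/
def triangle (x : ℝ) : ℝ := max (1 - |x|) 0

lemma continuous_triangle : Continuous triangle := by
  unfold triangle; fun_prop

lemma triangle_nonneg (x : ℝ) : 0 ≤ triangle x := le_max_right _ _

lemma triangle_neg (x : ℝ) : triangle (-x) = triangle x := by simp [triangle]

lemma triangle_eq_zero {x : ℝ} (h : 1 ≤ |x|) : triangle x = 0 :=
  max_eq_right (by linarith)

lemma hasCompactSupport_triangle : HasCompactSupport triangle :=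
  HasCompactSupport.of_support_subset_isCompact (isCompact_Icc (a := (-1 : ℝ)) (b := 1))
    fun x hx => by
      by_contra h
      refine hx (triangle_eq_zero ?_)
      rw [Set.mem_Icc, ← abs_le] at h
      linarith

lemma integrable_triangle : Integrable triangle :=
  continuous_triangle.integrable_of_hasCompactSupport hasCompactSupport_triangle

lemma integral_triangle_le : ∫ x, triangle x ≤ 2 := by
  have h : ∀ x, triangle x ≤ (Set.Icc (-1 : ℝ) 1).indicator (fun _ => 1) x := by
    intro x
    by_cases hx : x ∈ Set.Icc (-1 : ℝ) 1
    · rw [Set.indicator_of_mem hx]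
      exact max_le (by linarith [abs_nonneg x]) zero_le_one
    · rw [Set.indicator_of_notMem hx, triangle_eq_zero]
      rw [Set.mem_Icc, ← abs_le] at hx
      linarith
  refine (integral_mono integrable_triangle ?_ h).trans_eq ?_
  · exact (integrable_indicator_iff measurableSet_Icc).2 (by simp)
  · rw [integral_indicator measurableSet_Icc]
    simp
    norm_num

lemma norm_fourier_triangle_le (x : ℝ) : ‖𝓕 (fun t => (triangle t : ℂ)) x‖ ≤ 2 := by
  rw [Real.fourier_eq]
  refine (norm_integral_le_integral_norm _).trans (le_trans (le_of_eq ?_) integral_triangle_le)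
  refine integral_congr_ae (ae_of_all _ fun t => ?_)
  simp [abs_of_nonneg (triangle_nonneg t)]

/-- Explicit antiderivatives of `exp (c v) (1 ± v)` on the two halves of the support; the two
boundary terms `1 / c` cancel. -/
lemma fourier_triangle {x : ℝ} (hx : x ≠ 0) :
    𝓕 (fun t => (triangle t : ℂ)) x =
      (((1 - Real.cos (2 * Real.pi * x)) / (2 * Real.pi ^ 2 * x ^ 2) : ℝ) : ℂ) := by
  set c : ℂ := ((-2 * Real.pi * x : ℝ) : ℂ) * I with hc
  have hc0 : c ≠ 0 := by
    simp [hc, hx, Real.pi_ne_zero]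
  rw [Real.fourier_real_eq_integral_exp_smul]
  have e1 : ∀ v : ℝ, Complex.exp (((-2 * Real.pi * v * x : ℝ) : ℂ) * I) • (triangle v : ℂ) =
      Complex.exp (c * v) * (triangle v : ℂ) := by
    intro v
    rw [smul_eq_mul, hc]
    congr 2
    push_cast
    ring
  simp_rw [e1]
  have hcont : Continuous fun v : ℝ => Complex.exp (c * v) * (triangle v : ℂ) := by
    have := continuous_triangle
    fun_prop
  rw [← intervalIntegral.integral_eq_integral_of_support_subset (a := -1) (b := 1),
    ← intervalIntegral.integral_add_adjacent_intervals (b := 0)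
      (hcont.intervalIntegrable _ _) (hcont.intervalIntegrable _ _)]
  · have i1 : ∫ v in (-1 : ℝ)..0, Complex.exp (c * v) * (triangle v : ℂ) =
        1 / c - 1 / c ^ 2 + Complex.exp (-c) / c ^ 2 := by
      have : ∀ v ∈ Set.uIcc (-1 : ℝ) 0, HasDerivAt
          (fun v : ℝ => Complex.exp (c * v) * ((1 + v) / c - 1 / c ^ 2))
          (Complex.exp (c * v) * (triangle v : ℂ)) v := by
        intro v hv
        rw [Set.uIcc_of_le (by norm_num)] at hv
        have ht : triangle v = 1 + v := by
          rw [triangle, abs_of_nonpos hv.2, max_eq_left] <;> linarith [hv.1]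
        have d1 : HasDerivAt (fun v : ℝ => Complex.exp (c * v)) (Complex.exp (c * v) * (c * 1)) v :=
          ((Complex.ofRealCLM.hasDerivAt (x := v)).const_mul c).cexp
        have d2 : HasDerivAt (fun v : ℝ => (1 + (v : ℂ)) / c - 1 / c ^ 2) (1 / c) v := by
          have := ((Complex.ofRealCLM.hasDerivAt (x := v)).const_add (1 : ℂ)).div_const c
          simpa using this.sub_const (1 / c ^ 2)
        refine (d1.mul d2).congr_deriv ?_
        rw [ht]; push_cast; field_simp; ring
      rw [intervalIntegral.integral_eq_sub_of_hasDerivAt this (hcont.intervalIntegrable _ _)]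
      simp
      ring
    have i2 : ∫ v in (0 : ℝ)..1, Complex.exp (c * v) * (triangle v : ℂ) =
        Complex.exp c / c ^ 2 - 1 / c - 1 / c ^ 2 := by
      have : ∀ v ∈ Set.uIcc (0 : ℝ) 1, HasDerivAt
          (fun v : ℝ => Complex.exp (c * v) * ((1 - v) / c + 1 / c ^ 2))
          (Complex.exp (c * v) * (triangle v : ℂ)) v := by
        intro v hv
        rw [Set.uIcc_of_le (by norm_num)] at hv
        have ht : triangle v = 1 - v := by
          rw [triangle, abs_of_nonneg hv.1, max_eq_left]; linarith [hv.2]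
        have d1 : HasDerivAt (fun v : ℝ => Complex.exp (c * v)) (Complex.exp (c * v) * (c * 1)) v :=
          ((Complex.ofRealCLM.hasDerivAt (x := v)).const_mul c).cexp
        have d2 : HasDerivAt (fun v : ℝ => (1 - (v : ℂ)) / c + 1 / c ^ 2) (-1 / c) v := by
          have := ((Complex.ofRealCLM.hasDerivAt (x := v)).const_sub (1 : ℂ)).div_const c
          simpa using this.add_const (1 / c ^ 2)
        refine (d1.mul d2).congr_deriv ?_
        rw [ht]; push_cast; field_simp; ring
      rw [intervalIntegral.integral_eq_sub_of_hasDerivAt this (hcont.intervalIntegrable _ _)]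
      simp
      ring
    rw [i1, i2]
    have hcos : (Real.cos (2 * Real.pi * x) : ℂ) = (Complex.exp c + Complex.exp (-c)) / 2 := by
      rw [Complex.ofReal_cos, Complex.cos, hc]
      push_cast
      ring_nf
    have hc2 : c ^ 2 = -(4 * Real.pi ^ 2 * x ^ 2) := by
      rw [hc, mul_pow, I_sq]; push_cast; ring
    have hx' : (x : ℂ) ≠ 0 := by exact_mod_cast hx
    have hpi : (Real.pi : ℂ) ≠ 0 := by exact_mod_cast Real.pi_ne_zero
    have : (1 - (Real.cos (2 * Real.pi * x) : ℂ)) / (2 * Real.pi ^ 2 * x ^ 2) =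
        (2 * (Real.cos (2 * Real.pi * x) : ℂ) - 2) / c ^ 2 := by
      rw [hc2]; field_simp; ring
    push_cast at this hcos ⊢
    rw [this, hcos]
    ring
  · intro v hv
    have : triangle v ≠ 0 := by
      intro h; apply hv; simp [h]
    have h2 : |v| < 1 := by
      by_contra h; exact this (triangle_eq_zero (not_lt.1 h))
    exact ⟨(abs_lt.1 h2).1, (abs_lt.1 h2).2.le⟩

/-- The convolution square of the triangle function. -/
def bspline (x : ℝ) : ℝ := ∫ t, triangle t * triangle (x - t)

lemma bspline_nonneg (x : ℝ) : 0 ≤ bspline x :=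
  integral_nonneg fun _ => mul_nonneg (triangle_nonneg _) (triangle_nonneg _)

lemma bspline_neg (x : ℝ) : bspline (-x) = bspline x := by
  unfold bspline
  rw [← integral_neg_eq_self]
  refine integral_congr_ae (ae_of_all _ fun t => ?_)
  simp only [triangle_neg]
  rw [← triangle_neg (-x - -t)]
  ring_nf

lemma bspline_eq_zero {x : ℝ} (h : 2 ≤ |x|) : bspline x = 0 := by
  unfold bspline
  refine integral_eq_zero_of_ae (ae_of_all _ fun t => ?_)
  by_cases ht : 1 ≤ |t|
  · simp [triangle_eq_zero ht]
  · have : 1 ≤ |x - t| := by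
      have := abs_sub_abs_le_abs_sub x t
      linarith
    simp [triangle_eq_zero this]

lemma bspline_eq_convolution :
    bspline = convolution triangle triangle (ContinuousLinearMap.mul ℝ ℝ) volume := rfl

lemma ofReal_bspline :
    (fun x => (bspline x : ℂ)) =
      convolution (fun t => (triangle t : ℂ)) (fun t => (triangle t : ℂ))
        (ContinuousLinearMap.mul ℂ ℂ) volume := by
  ext x
  rw [convolution, bspline, ← integral_complex_ofReal]
  simp

lemma continuous_bspline : Continuous bspline := by
  rw [bspline_eq_convolution]
  exact hasCompactSupport_triangle.continuous_convolution_right _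
    continuous_triangle.locallyIntegrable continuous_triangle

lemma hasCompactSupport_bspline : HasCompactSupport bspline :=
  HasCompactSupport.of_support_subset_isCompact (isCompact_Icc (a := (-2 : ℝ)) (b := 2))
    fun x hx => by
      by_contra h
      refine hx (bspline_eq_zero ?_)
      rw [Set.mem_Icc, ← abs_le] at h
      linarith

lemma bspline_zero_pos : 0 < bspline 0 := by
  unfold bspline
  refine Continuous.integral_pos_of_hasCompactSupport_nonneg_nonzero (x := 0) ?_ ?_ ?_ ?_
  · have := continuous_triangle; fun_prop
  · exact hasCompactSupport_triangle.mul_right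
  · exact fun t => mul_nonneg (triangle_nonneg _) (triangle_nonneg _)
  · simp [triangle]

lemma fourier_bspline (x : ℝ) :
    𝓕 (fun t => (bspline t : ℂ)) x = (𝓕 (fun t => (triangle t : ℂ)) x) ^ 2 := by
  rw [ofReal_bspline, sq]
  exact Real.fourier_mul_convolution_eq (R := ℂ) integrable_triangle.ofReal
    integrable_triangle.ofReal x

/-- The Fourier transform of `bspline`, which is a multiple of `sinc⁴` away from the origin. -/
def bsplineFourier (x : ℝ) : ℝ := ((𝓕 (fun t => (triangle t : ℂ)) x).re) ^ 2

lemma fourier_triangle_im (x : ℝ) : (𝓕 (fun t => (triangle t : ℂ)) x).im = 0 := by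
  by_cases hx : x = 0
  · subst hx
    rw [Real.fourier_real_eq_integral_exp_smul]
    simp
    rw [integral_complex_ofReal, ofReal_im]
  · rw [fourier_triangle hx, ofReal_im]

lemma fourier_bspline_eq (x : ℝ) : 𝓕 (fun t => (bspline t : ℂ)) x = bsplineFourier x := by
  rw [fourier_bspline, bsplineFourier]
  have : 𝓕 (fun t => (triangle t : ℂ)) x = ((𝓕 (fun t => (triangle t : ℂ)) x).re : ℂ) := by
    apply Complex.ext <;> simp [fourier_triangle_im]
  rw [this]; simp

/-- The transform has the decay of `tail` but vanishes at the nonzero integers, so the factor `(1 -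
cos)²` has to stay. Translates by `1/2` remove it in `exists_tail_le_baseDensity`. -/
lemma bsplineFourier_ge (x : ℝ) :
    (1 - Real.cos (2 * Real.pi * x)) ^ 2 / (4 * Real.pi ^ 4) * tail x ≤ bsplineFourier x := by
  by_cases hx : x = 0
  · simp [hx, bsplineFourier]; positivity
  · rw [bsplineFourier, fourier_triangle hx, ofReal_re, tail, div_pow, ← div_eq_mul_inv, div_div]
    refine div_le_div_of_nonneg_left (by positivity) (by positivity) ?_
    have : (x ^ 2) ^ 2 ≤ (1 + x ^ 2) ^ 2 := pow_le_pow_left₀ (sq_nonneg x) (by linarith) 2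
    have hp : 0 < 4 * Real.pi ^ 4 := by positivity
    nlinarith

/-- The bound `2` on the transform of the triangle controls small `x`, the bound `1 / x²` large `x`;
together they give `3 / (1 + x²)`, which is then squared. -/
lemma bsplineFourier_le (x : ℝ) : bsplineFourier x ≤ 9 * tail x := by
  have h : |(𝓕 (fun t => (triangle t : ℂ)) x).re| ≤ 3 / (1 + x ^ 2) := by
    rw [le_div_iff₀ (by positivity)]
    have h2 : |(𝓕 (fun t => (triangle t : ℂ)) x).re| ≤ 2 :=
      (abs_re_le_norm _).trans (norm_fourier_triangle_le x)
    by_cases hx : x = 0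
    · subst hx; linarith
    · have h1 : |(𝓕 (fun t => (triangle t : ℂ)) x).re| * x ^ 2 ≤ 1 := by
        rw [fourier_triangle hx, ofReal_re, abs_of_nonneg
          (div_nonneg (by linarith [Real.cos_le_one (2 * Real.pi * x)]) (by positivity))]
        have hx2 : 0 < x ^ 2 := by positivity
        rw [div_mul_eq_mul_div, div_le_one (by positivity)]
        have := Real.neg_one_le_cos (2 * Real.pi * x)
        have hp : 1 ≤ Real.pi ^ 2 := one_le_pow₀ (by linarith [Real.pi_gt_three])
        nlinarith
      linarith
  unfold bsplineFourier tail
  calc _ = |(𝓕 (fun t => (triangle t : ℂ)) x).re| ^ 2 := (sq_abs _).symm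
    _ ≤ (3 / (1 + x ^ 2)) ^ 2 := pow_le_pow_left₀ (abs_nonneg _) h 2
    _ = _ := by rw [div_pow]; ring

/-! ### The base density and its compactly supported characteristic function. -/

lemma fourier_modulate (w : ℝ → ℂ) (a x : ℝ) :
    𝓕 (fun ξ : ℝ => Complex.exp (((2 * Real.pi * a * ξ : ℝ) : ℂ) * I) * w ξ) x = 𝓕 w (x - a) := by
  rw [Real.fourier_real_eq_integral_exp_smul, Real.fourier_real_eq_integral_exp_smul]
  refine integral_congr_ae (ae_of_all _ fun v => ?_)
  simp only [smul_eq_mul]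
  rw [← mul_assoc, ← Complex.exp_add]
  congr 2
  push_cast
  ring

lemma fourier_add_apply {f g : ℝ → ℂ} (hf : Integrable f) (hg : Integrable g) (x : ℝ) :
    𝓕 (fun ξ => f ξ + g ξ) x = 𝓕 f x + 𝓕 g x := by
  simp only [Real.fourier_eq, smul_add]
  exact integral_add ((Real.fourierIntegral_convergent_iff x).2 hf)
    ((Real.fourierIntegral_convergent_iff x).2 hg)

lemma fourier_const_mul_apply (r : ℂ) (f : ℝ → ℂ) (x : ℝ) :
    𝓕 (fun ξ => r * f ξ) x = r * 𝓕 f x := by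
  have e : (fun ξ => r * f ξ) = r • f := by ext; simp
  rw [e]
  simp only [Real.fourier_eq, Pi.smul_apply, smul_comm _ r]
  rw [integral_smul, smul_eq_mul]

/-- The compactly supported characteristic function `bspline ξ * (1 + cos (π ξ))`, normalized. -/
def baseChar (ξ : ℝ) : ℝ := bspline ξ * (1 + Real.cos (Real.pi * ξ)) / (2 * bspline 0)

/-- The density with characteristic function `baseChar` (in the Fourier normalization). -/
def baseDensity (x : ℝ) : ℝ :=
  (bsplineFourier x + (bsplineFourier (x - 1 / 2) + bsplineFourier (x + 1 / 2)) / 2)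
    / (2 * bspline 0)

lemma continuous_baseChar : Continuous baseChar := by
  have := continuous_bspline
  unfold baseChar; fun_prop

lemma baseChar_nonneg (ξ : ℝ) : 0 ≤ baseChar ξ :=
  div_nonneg (mul_nonneg (bspline_nonneg _) (by linarith [Real.neg_one_le_cos (Real.pi * ξ)]))
    (by linarith [bspline_zero_pos])

lemma baseChar_neg (ξ : ℝ) : baseChar (-ξ) = baseChar ξ := by
  simp [baseChar, bspline_neg]

lemma baseChar_zero : baseChar 0 = 1 := by
  have := bspline_zero_pos.ne'
  simp [baseChar]; field_simp; norm_num

lemma baseChar_eq_zero {ξ : ℝ} (h : 2 ≤ |ξ|) : baseChar ξ = 0 := by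
  simp [baseChar, bspline_eq_zero h]

lemma integrable_baseChar : Integrable (fun ξ => (baseChar ξ : ℂ)) :=
  (continuous_baseChar.integrable_of_hasCompactSupport
    (HasCompactSupport.of_support_subset_isCompact (isCompact_Icc (a := (-2 : ℝ)) (b := 2))
    fun x hx => by
      by_contra h
      refine hx (baseChar_eq_zero ?_)
      rw [Set.mem_Icc, ← abs_le] at h
      linarith)).ofReal

lemma fourier_baseChar (x : ℝ) : 𝓕 (fun ξ => (baseChar ξ : ℂ)) x = baseDensity x := by
  have hB : Integrable (fun t => (bspline t : ℂ)) :=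
    (continuous_bspline.integrable_of_hasCompactSupport hasCompactSupport_bspline).ofReal
  set e : ℝ → ℝ → ℂ := fun a ξ => Complex.exp (((2 * Real.pi * a * ξ : ℝ) : ℂ) * I) * bspline ξ
    with he
  have hm : ∀ a, Integrable (e a) := fun a => by
    refine hB.norm.mono' ?_ (ae_of_all _ fun ξ => ?_)
    · have := continuous_bspline
      exact Continuous.aestronglyMeasurable (by fun_prop)
    · rw [he]; simp only [norm_mul, Complex.norm_exp_ofReal_mul_I, one_mul]; exact le_rfl
  have hdec : (fun ξ => (baseChar ξ : ℂ)) = ((2 * bspline 0 : ℝ) : ℂ)⁻¹ •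
      ((fun ξ => (bspline ξ : ℂ)) + (2 : ℂ)⁻¹ • (e (1 / 2) + e (-(1 / 2)))) := by
    ext ξ
    simp only [baseChar, he, Pi.smul_apply, Pi.add_apply, smul_eq_mul]
    rw [← add_mul]
    have : (Real.cos (Real.pi * ξ) : ℂ) = (2 : ℂ)⁻¹ *
        (Complex.exp (((2 * Real.pi * (1 / 2) * ξ : ℝ) : ℂ) * I) +
          Complex.exp (((2 * Real.pi * -(1 / 2) * ξ : ℝ) : ℂ) * I)) := by
      rw [Complex.ofReal_cos, Complex.cos, div_eq_inv_mul]
      congr 3 <;> congr 1 <;> push_cast <;> ring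
    push_cast at this ⊢
    rw [this]
    ring
  have hadd : ∀ {f g : ℝ → ℂ}, Integrable f → Integrable g → 𝓕 (f + g) x = 𝓕 f x + 𝓕 g x :=
    fun hf hg => fourier_add_apply hf hg x
  have hsm : ∀ (r : ℂ) (f : ℝ → ℂ), 𝓕 (r • f) x = r * 𝓕 f x :=
    fun r f => fourier_const_mul_apply r f x
  rw [hdec, hsm, hadd hB (((hm _).add (hm _)).smul _), hsm, hadd (hm _) (hm _), he]
  simp only [fourier_modulate, fourier_bspline_eq, baseDensity]
  push_cast
  rw [sub_neg_eq_add]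
  ring

/-- Multiplying the characteristic function by `1 + cos (π ξ)` adds translates by `±1/2` to the
density. Such a translation replaces `1 - cos (2πx)` by `1 + cos (2πx)`, and these two never vanish
together. -/
lemma exists_tail_le_baseDensity : ∃ c : ℝ, 0 < c ∧ ∀ x, c * tail x ≤ baseDensity x := by
  have hB := bspline_zero_pos
  refine ⟨(8 / 25) / (4 * Real.pi ^ 4) / (2 * bspline 0), by positivity, fun x => ?_⟩
  rw [baseDensity, div_mul_eq_mul_div]
  refine div_le_div_of_nonneg_right ?_ (by positivity)
  set y := Real.cos (2 * Real.pi * x)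
  have h1 := bsplineFourier_ge x
  -- For `s = ±1/2`, `tail s = 16/25`, and `tail_mul_le` gives `tail (x - s) ≥ (4/25) tail x`.
  have hs : ∀ s : ℝ, tail s = 16 / 25 → Real.cos (2 * Real.pi * (x - s)) = -y →
      (1 + y) ^ 2 / (4 * Real.pi ^ 4) * (4 / 25 * tail x) ≤ bsplineFourier (x - s) := by
    intro s hs hc
    have h2 := bsplineFourier_ge (x - s)
    rw [hc, sub_neg_eq_add] at h2
    refine le_trans (mul_le_mul_of_nonneg_left ?_ (by positivity)) h2
    have := tail_mul_le x s
    rw [hs] at this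
    linarith
  have h2 := hs (1 / 2) (by norm_num [tail])
    (by rw [show 2 * Real.pi * (x - 1 / 2) = 2 * Real.pi * x - Real.pi by ring, Real.cos_sub_pi])
  have h3 := hs (-(1 / 2)) (by norm_num [tail])
    (by rw [show 2 * Real.pi * (x - -(1 / 2)) = 2 * Real.pi * x + Real.pi by ring, Real.cos_add_pi])
  rw [sub_neg_eq_add] at h3
  have ht := tail_pos x
  have h4 : 8 / 25 * tail x ≤ (1 - y) ^ 2 * tail x + (1 + y) ^ 2 * (4 / 25 * tail x) := by
    -- Lowering the first coefficient to `4/25` leaves `(4/25) (2 + 2 y²) ≥ 8/25`.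
    have : (8 : ℝ) / 25 ≤ (1 - y) ^ 2 + (1 + y) ^ 2 * (4 / 25) := by
      nlinarith [sq_nonneg y, sq_nonneg (1 - y)]
    nlinarith
  have hp : 0 < 4 * Real.pi ^ 4 := by positivity
  calc 8 / 25 / (4 * Real.pi ^ 4) * tail x = (8 / 25 * tail x) / (4 * Real.pi ^ 4) := by ring
    _ ≤ ((1 - y) ^ 2 * tail x + (1 + y) ^ 2 * (4 / 25 * tail x)) / (4 * Real.pi ^ 4) := by gcongr
    _ = (1 - y) ^ 2 / (4 * Real.pi ^ 4) * tail x +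
        (1 + y) ^ 2 / (4 * Real.pi ^ 4) * (4 / 25 * tail x) := by ring
    _ ≤ _ := by linarith

lemma exists_baseDensity_le_tail : ∃ C : ℝ, 0 < C ∧ ∀ x, baseDensity x ≤ C * tail x := by
  have hB := bspline_zero_pos
  -- Each translate costs a factor `25/4`, so the numerator is at most `9 (1 + 25/4) tail x`, and
  -- `100` is a generous bound.
  refine ⟨100 / (2 * bspline 0), by positivity, fun x => ?_⟩
  rw [baseDensity, div_mul_eq_mul_div]
  refine div_le_div_of_nonneg_right ?_ (by positivity)
  have h1 := bsplineFourier_le x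
  have hs : ∀ s : ℝ, tail s = 16 / 25 → tail (x + s) ≤ 25 / 4 * tail x := by
    intro s hs
    have := tail_mul_le (x + s) s
    rw [hs, add_sub_cancel_right] at this
    linarith
  have h2 := (bsplineFourier_le (x + 1 / 2))
  have h3 := (bsplineFourier_le (x - 1 / 2))
  have h4 := hs (1 / 2) (by norm_num [tail])
  have h5 := hs (-(1 / 2)) (by norm_num [tail])
  rw [← sub_eq_add_neg] at h5
  linarith [tail_pos x]

/-! ### The polynomial weight as a symbol. -/

/-- The weight `(1 + ξ²)^(-β/2)`. -/
def japanese (β ξ : ℝ) : ℝ := (1 + ξ ^ 2) ^ (-(β / 2))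

lemma japanese_pos (β ξ : ℝ) : 0 < japanese β ξ := Real.rpow_pos_of_pos (by positivity) _

lemma japanese_neg (β ξ : ℝ) : japanese β (-ξ) = japanese β ξ := by simp [japanese]

lemma integrable_japanese {β : ℝ} (hβ : 1 < β) : Integrable (japanese β) := by
  have := integrable_rpow_neg_one_add_norm_sq (E := ℝ) (μ := volume) (r := β) (by simpa using hβ)
  refine this.congr (ae_of_all _ fun x => ?_)
  simp [japanese, neg_div]

lemma norm_one_add_mul_I_cpow (a ξ : ℝ) :
    ‖(1 + ξ * I : ℂ) ^ ((-a : ℝ) : ℂ)‖ = japanese a ξ := by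
  have h : (1 + ξ * I : ℂ) ≠ 0 := fun h => by simpa using congrArg Complex.re h
  rw [Complex.norm_cpow_of_ne_zero h]
  have hn : ‖(1 + ξ * I : ℂ)‖ = Real.sqrt (1 + ξ ^ 2) := by
    have := Complex.norm_add_mul_I 1 ξ
    simpa using this
  rw [hn, Real.sqrt_eq_rpow, ← Real.rpow_mul (by positivity), japanese, ofReal_re, ofReal_im]
  simp
  ring_nf

lemma iteratedDeriv_one_add_mul_I_cpow (k : ℕ) : ∀ a : ℝ, ∃ c : ℂ,
    iteratedDeriv k (fun ξ : ℝ => (1 + ξ * I : ℂ) ^ ((-a : ℝ) : ℂ)) =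
      fun ξ : ℝ => c * (1 + ξ * I : ℂ) ^ ((-(a + k) : ℝ) : ℂ) := by
  induction k with
  | zero => exact fun a => ⟨1, by ext; simp⟩
  | succ k ih =>
    intro a
    obtain ⟨c, hc⟩ := ih a
    refine ⟨c * (((-(a + k) : ℝ) : ℂ) * I), ?_⟩
    rw [iteratedDeriv_succ, hc]
    ext ξ
    have h : (1 + ξ * I : ℂ) ∈ slitPlane := Or.inl (by simp)
    have d1 : HasDerivAt (fun ξ : ℝ => (1 + ξ * I : ℂ)) I ξ := by
      simpa using ((Complex.ofRealCLM.hasDerivAt (x := ξ)).mul_const I).const_add (1 : ℂ)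
    have d2 := (HasDerivAt.comp ξ (((hasDerivAt_id (1 + ξ * I : ℂ)).cpow_const
      (c := ((-(a + k) : ℝ) : ℂ)) h)) d1).const_mul c
    refine d2.deriv.trans ?_
    have : (((-(a + k) : ℝ) : ℂ) - 1) = ((-(a + (k + 1 : ℕ)) : ℝ) : ℂ) := by push_cast; ring
    simp only [id, mul_one]
    rw [this]
    ring

lemma japanese_anti {a b : ℝ} (h : a ≤ b) (ξ : ℝ) : japanese b ξ ≤ japanese a ξ :=
  Real.rpow_le_rpow_of_exponent_le (by nlinarith [sq_nonneg ξ]) (by linarith)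

lemma exists_symbolBound_cpow (a : ℝ) : ∃ A, 0 ≤ A ∧
    SymbolBound (japanese a) A (fun ξ : ℝ => (1 + ξ * I : ℂ) ^ ((-a : ℝ) : ℂ)) := by
  choose c hc using fun k => iteratedDeriv_one_add_mul_I_cpow k a
  refine ⟨∑ k ∈ Finset.range 5, ‖c k‖, Finset.sum_nonneg fun _ _ => norm_nonneg _, ?_, ?_⟩
  · rw [contDiff_iff_contDiffAt]
    intro ξ
    have h : (1 + ξ * I : ℂ) ∈ slitPlane := Or.inl (by simp)
    refine ContDiffAt.fun_comp (𝕜 := ℝ) (g := fun z : ℂ => z ^ ((-a : ℝ) : ℂ))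
      (f := fun ξ : ℝ => (1 + ξ * I : ℂ)) ξ ?_ ?_
    · refine ContDiffAt.restrict_scalars ℝ (𝕜' := ℂ) ?_
      exact (analyticAt_id.cpow analyticAt_const h).contDiffAt
    · exact (contDiff_const.add (Complex.ofRealCLM.contDiff.mul contDiff_const)).contDiffAt
  · intro k hk x
    rw [hc k]
    simp only [norm_mul]
    rw [norm_one_add_mul_I_cpow]
    refine mul_le_mul ?_ (japanese_anti (by simp) x) (japanese_pos _ _).le
      (Finset.sum_nonneg fun _ _ => norm_nonneg _)
    exact Finset.single_le_sum (f := fun k => ‖c k‖) (fun _ _ => norm_nonneg _)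
      (by simp; omega)

/-- The weight is `|(1 + iξ) ^ (-β/2)|²`, the product of a power of `1 + iξ` with its reflection `ξ
↦ -ξ`, which is its conjugate. Derivatives of such a power are multiples of powers that decay
faster, so the product rule suffices. -/
lemma exists_symbolBound_japanese (β : ℝ) : ∃ A, 0 ≤ A ∧
    SymbolBound (japanese β) A (fun ξ => (japanese β ξ : ℂ)) := by
  obtain ⟨A, hA, h⟩ := exists_symbolBound_cpow (β / 2)
  refine ⟨16 * A * A, by positivity, ?_⟩
  have key : ∀ ξ, japanese (β / 2) ξ * japanese (β / 2) ξ = japanese β ξ := fun ξ => by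
    rw [japanese, ← Real.rpow_add (by positivity), japanese]; ring_nf
  convert h.mul h.comp_neg using 1
  · ext ξ; rw [japanese_neg, key]
  · ext ξ
    have hc : (1 + ((-ξ : ℝ) : ℂ) * I) = (starRingEnd ℂ) (1 + ξ * I) := by simp
    have harg : (1 + ξ * I : ℂ).arg ≠ Real.pi :=
      (Complex.mem_slitPlane_iff_arg.1 (Or.inl (by simp))).1
    have hp : (1 + ((-ξ : ℝ) : ℂ) * I) ^ ((-(β / 2) : ℝ) : ℂ) =
        (starRingEnd ℂ) ((1 + ξ * I) ^ ((-(β / 2) : ℝ) : ℂ)) := by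
      rw [hc, Complex.conj_cpow _ _ harg, Complex.conj_ofReal]
    rw [hp, Complex.mul_conj, Complex.normSq_eq_norm_sq, norm_one_add_mul_I_cpow, sq, key]

/-! ### Smooth cutoffs, the dip, the twist and the carrier. -/

/-- Smooth transition from `0` on `(-∞, -1]` to `1` on `[0, ∞)`. -/
def step (x : ℝ) : ℝ := Real.smoothTransition (x + 1)

lemma step_eq_zero {x : ℝ} (h : x ≤ -1) : step x = 0 :=
  Real.smoothTransition.zero_of_nonpos (by linarith)

lemma step_eq_one {x : ℝ} (h : 0 ≤ x) : step x = 1 :=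
  Real.smoothTransition.one_of_one_le (by linarith)

lemma step_nonneg (x : ℝ) : 0 ≤ step x := Real.smoothTransition.nonneg _

lemma step_le_one (x : ℝ) : step x ≤ 1 := Real.smoothTransition.le_one _

lemma contDiff_step : ContDiff ℝ 4 (fun x => (step x : ℂ)) :=
  Complex.ofRealCLM.contDiff.comp
    (Real.smoothTransition.contDiff.comp (contDiff_id.add contDiff_const))

/-- Compactness bounds the derivatives on `[-1, 0]`; off this interval `step` is locally constant.
-/
lemma exists_symbolBound_step : ∃ A, 0 ≤ A ∧
    SymbolBound (fun _ => 1) A (fun x => (step x : ℂ)) := by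
  have hb : ∀ k : ℕ, ∃ A, 0 ≤ A ∧ (k ≤ 4 → ∀ x, ‖iteratedDeriv k (fun x => (step x : ℂ)) x‖ ≤ A) := by
    intro k
    by_cases hk : k ≤ 4
    · obtain ⟨A, hA⟩ := (isCompact_Icc (a := (-1 : ℝ)) (b := 0)).exists_bound_of_continuousOn
        (contDiff_step.continuous_iteratedDeriv k (by exact_mod_cast hk)).continuousOn
      refine ⟨max A 1, by positivity, fun _ x => ?_⟩
      by_cases hx : x ∈ Set.Icc (-1 : ℝ) 0
      · exact (hA x hx).trans (le_max_left _ _)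
      · refine le_trans ?_ (le_max_right _ _)
        have : ∃ c : ℂ, ‖c‖ ≤ 1 ∧ (fun x => (step x : ℂ)) =ᶠ[nhds x] fun _ => c := by
          rw [Set.mem_Icc, not_and_or, not_le, not_le] at hx
          rcases hx with hx | hx
          · refine ⟨0, by simp, ?_⟩
            filter_upwards [Iio_mem_nhds hx] with y hy
            simp [step_eq_zero (le_of_lt hy)]
          · refine ⟨1, by simp, ?_⟩
            filter_upwards [Ioi_mem_nhds hx] with y hy
            simp [step_eq_one (le_of_lt hy)]
        obtain ⟨c, hc, he⟩ := this
        rw [he.iteratedDeriv_eq, iteratedDeriv_const]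
        split_ifs <;> simp [hc]
    · exact ⟨0, le_rfl, fun h => absurd h hk⟩
  choose A hA0 hA using hb
  refine ⟨∑ k ∈ Finset.range 5, A k, Finset.sum_nonneg fun _ _ => hA0 _, contDiff_step,
    fun k hk x => ?_⟩
  rw [mul_one]
  exact (hA k hk x).trans (Finset.single_le_sum (f := A) (fun _ _ => hA0 _) (by simp; omega))

/-- A smooth bump, equal to `1` on `[-1, 1]` and supported in `[-2, 2]`. -/
def bump (x : ℝ) : ℝ := step (1 + x) * step (1 - x)

lemma bump_nonneg (x : ℝ) : 0 ≤ bump x := mul_nonneg (step_nonneg _) (step_nonneg _)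

lemma bump_le_one (x : ℝ) : bump x ≤ 1 :=
  mul_le_one₀ (step_le_one _) (step_nonneg _) (step_le_one _)

lemma bump_eq_one {x : ℝ} (h : |x| ≤ 1) : bump x = 1 := by
  have := abs_le.1 h
  rw [bump, step_eq_one (by linarith), step_eq_one (by linarith), one_mul]

lemma bump_eq_zero {x : ℝ} (h : 2 ≤ |x|) : bump x = 0 := by
  rcases le_abs.1 h with h | h
  · rw [bump, step_eq_zero (x := 1 - x) (by linarith), mul_zero]
  · rw [bump, step_eq_zero (x := 1 + x) (by linarith), zero_mul]

lemma bump_neg (x : ℝ) : bump (-x) = bump x := by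
  simp only [bump]; rw [mul_comm, sub_neg_eq_add, ← sub_eq_add_neg]

lemma exists_symbolBound_bump : ∃ A, 0 ≤ A ∧
    SymbolBound (fun _ => 1) A (fun x => (bump x : ℂ)) := by
  obtain ⟨A, hA, h⟩ := exists_symbolBound_step
  refine ⟨16 * A * A, by positivity, ?_⟩
  have h1 := h.comp_sub_const (-1)
  have h2 := h1.comp_neg
  convert h1.mul h2 using 1
  · simp
  · ext x
    simp only [bump]
    push_cast
    congr 3 <;> ring

/-- Two copies of `bump`, centred at `m` and `-m`. -/
def bumpPair (m ξ : ℝ) : ℝ := bump (ξ - m) + bump (ξ + m)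

/-- The odd function which is `0` near the origin, `1` on `[m, ∞)` and `-1` on `(-∞, -m]`. -/
def phase (m ξ : ℝ) : ℝ := step (ξ - m) - step (-ξ - m)

lemma bumpPair_neg (m ξ : ℝ) : bumpPair m (-ξ) = bumpPair m ξ := by
  rw [bumpPair, bumpPair, ← bump_neg (-ξ - m), ← bump_neg (-ξ + m), add_comm]
  congr 2 <;> ring

lemma phase_neg (m ξ : ℝ) : phase m (-ξ) = -phase m ξ := by
  simp [phase]

lemma bumpPair_eq_abs (m ξ : ℝ) : bumpPair m ξ = bumpPair m |ξ| := by
  rcases abs_choice ξ with h | h <;> rw [h]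
  rw [bumpPair_neg]

lemma bumpPair_of_nonneg {m ξ : ℝ} (hm : 2 ≤ m) (h : 0 ≤ ξ) : bumpPair m ξ = bump (ξ - m) := by
  rw [bumpPair, bump_eq_zero (x := ξ + m), add_zero]
  rw [abs_of_nonneg] <;> linarith

lemma bumpPair_eq {m : ℝ} (hm : 2 ≤ m) (ξ : ℝ) : bumpPair m ξ = bump (|ξ| - m) := by
  rw [bumpPair_eq_abs, bumpPair_of_nonneg hm (abs_nonneg ξ)]

/-- The phase changes only for `m - 1 ≤ |ξ| ≤ m`, a range inside the region `||ξ| - m| ≤ 1` where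
`dip` equals `ε`. -/
lemma phase_eq_zero {m ξ : ℝ} (h : |ξ| ≤ m - 1) : phase m ξ = 0 := by
  have := abs_le.1 h
  rw [phase, step_eq_zero (by linarith), step_eq_zero (by linarith), sub_zero]

lemma phase_eq_one {m ξ : ℝ} (hm : 1 ≤ m) (h : m ≤ ξ) : phase m ξ = 1 := by
  rw [phase, step_eq_one (by linarith), step_eq_zero (by linarith), sub_zero]

lemma phase_eq_neg_one {m ξ : ℝ} (hm : 1 ≤ m) (h : ξ ≤ -m) : phase m ξ = -1 := by
  rw [phase, step_eq_zero (by linarith), step_eq_one (by linarith), zero_sub]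

lemma exists_symbolBound_bumpPair : ∃ A, 0 ≤ A ∧ ∀ m,
    SymbolBound (fun _ => 1) A (fun ξ => (bumpPair m ξ : ℂ)) := by
  obtain ⟨A, hA, h⟩ := exists_symbolBound_bump
  refine ⟨A + A, by positivity, fun m => ?_⟩
  have := (h.comp_sub_const m).add (h.comp_sub_const (-m))
  simpa [bumpPair] using this

lemma exists_symbolBound_phase : ∃ A, 0 ≤ A ∧ ∀ m,
    SymbolBound (fun _ => 1) A (fun ξ => (phase m ξ : ℂ)) := by
  obtain ⟨A, hA, h⟩ := exists_symbolBound_step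
  refine ⟨A + A, by positivity, fun m => ?_⟩
  have := (h.comp_sub_const m).sub (h.comp_sub_const m).comp_neg
  simpa [phase] using this

/-- The unimodular factor turning by the angle `θ` when `|ξ|` passes `m`. -/
def twist (θ m ξ : ℝ) : ℂ := Complex.exp (((θ * phase m ξ : ℝ) : ℂ) * I)

lemma norm_twist (θ m ξ : ℝ) : ‖twist θ m ξ‖ = 1 := Complex.norm_exp_ofReal_mul_I _

lemma twist_eq_one {θ m ξ : ℝ} (h : |ξ| ≤ m - 1) : twist θ m ξ = 1 := by
  simp [twist, phase_eq_zero h]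

lemma twist_neg (θ m ξ : ℝ) : twist θ m (-ξ) = (starRingEnd ℂ) (twist θ m ξ) := by
  rw [twist, twist, phase_neg, ← Complex.exp_conj]
  simp

lemma twist_zero (m ξ : ℝ) : twist 0 m ξ = 1 := by simp [twist]

lemma twist_pow (θ m ξ : ℝ) (K : ℕ) : twist θ m ξ ^ K = twist (K * θ) m ξ := by
  rw [twist, twist, ← Complex.exp_nat_mul]
  push_cast
  ring_nf

/-- The derivative of `twist` is `iθ phase' * twist`, so bounds on the derivatives propagate by
induction on the order. They are uniform in `m` because those of `phase` are, being built from
translates of `step`. -/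
lemma exists_symbolBound_twist (Θ : ℝ) (hΘ : 0 ≤ Θ) : ∃ A, 0 ≤ A ∧ ∀ m θ, |θ| ≤ Θ →
    SymbolBound (fun _ => 1) A (twist θ m) := by
  obtain ⟨B, hB, hph⟩ := exists_symbolBound_phase
  have hcd : ∀ θ m, ContDiff ℝ 4 (twist θ m) := fun θ m => by
    have : twist θ m = fun ξ => Complex.exp (θ * I * (phase m ξ : ℂ)) := by
      ext ξ; rw [twist]; push_cast; ring_nf
    rw [this]
    exact (contDiff_const.mul (hph m).contDiff).cexp
  have hd : ∀ θ m, deriv (twist θ m) =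
      fun ξ => (θ * I * deriv (fun ξ => (phase m ξ : ℂ)) ξ) * twist θ m ξ := fun θ m => by
    have : twist θ m = fun ξ => Complex.exp (θ * I * (phase m ξ : ℂ)) := by
      ext ξ; rw [twist]; push_cast; ring_nf
    ext ξ
    have d : HasDerivAt (fun ξ => (phase m ξ : ℂ)) (deriv (fun ξ => (phase m ξ : ℂ)) ξ) ξ :=
      ((hph m).contDiff.differentiable (by norm_num) ξ).hasDerivAt
    rw [this, ((d.const_mul (θ * I)).cexp).deriv]
    ring
  -- All orders `j ≤ k` share one constant, since the Leibniz rule at order `k + 1` uses every lower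
  -- order.
  have main : ∀ k : ℕ, ∃ A, 0 ≤ A ∧ (k ≤ 4 → ∀ j ≤ k, ∀ m θ, |θ| ≤ Θ → ∀ x,
      ‖iteratedDeriv j (twist θ m) x‖ ≤ A) := by
    intro k
    induction k with
    | zero =>
      refine ⟨1, zero_le_one, fun _ j hj m θ _ x => ?_⟩
      obtain rfl : j = 0 := by omega
      simp [norm_twist]
    | succ k ih =>
      obtain ⟨A, hA0, hA⟩ := ih
      refine ⟨max A (16 * (Θ * B * A)), le_max_of_le_left hA0, fun hk j hj m θ hθ x => ?_⟩
      rcases Nat.lt_or_ge k j with h | h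
      · obtain rfl : j = k + 1 := by omega
        refine le_trans ?_ (le_max_right _ _)
        have hk' : ((k + 1 : ℕ) : WithTop ℕ∞) ≤ 4 := by exact_mod_cast hk
        have hk'' : (k : WithTop ℕ∞) ≤ 4 := le_trans (by exact_mod_cast Nat.le_succ k) hk'
        have c1 : ContDiff ℝ k (fun ξ => θ * I * deriv (fun ξ => (phase m ξ : ℂ)) ξ) := by
          refine contDiff_const.mul ?_
          have := ((hph m).contDiff.of_le hk')
          push_cast at this
          exact (contDiff_succ_iff_deriv.1 this).2.2
        rw [iteratedDeriv_succ', hd, show (fun ξ => (θ * I * deriv (fun ξ => (phase m ξ : ℂ)) ξ) *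
          twist θ m ξ) = (fun ξ => θ * I * deriv (fun ξ => (phase m ξ : ℂ)) ξ) * twist θ m from rfl,
          iteratedDeriv_mul c1.contDiffAt ((hcd θ m).of_le hk'').contDiffAt]
        calc _ ≤ ∑ i ∈ Finset.range (k + 1), (k.choose i : ℝ) * (Θ * B * A) := by
              refine (norm_sum_le _ _).trans (Finset.sum_le_sum fun i hi => ?_)
              have hi' : i ≤ k := by simpa [Nat.lt_succ_iff] using hi
              rw [norm_mul, norm_mul, mul_assoc]
              refine mul_le_mul (by simp) ?_ (by positivity) (by positivity)
              refine mul_le_mul ?_ (hA (by omega) _ (by omega) m θ hθ x) (norm_nonneg _)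
                (by positivity)
              rw [iteratedDeriv_const_mul_field, ← iteratedDeriv_succ', norm_mul]
              refine mul_le_mul ?_ ?_ (norm_nonneg _) hΘ
              · simpa using hθ
              · simpa using (hph m).bound (i + 1) (by omega) x
          _ = 2 ^ k * (Θ * B * A) := by
              rw [← Finset.sum_mul]
              congr 1
              exact_mod_cast Nat.sum_range_choose k
          _ ≤ 16 * (Θ * B * A) := by
              refine mul_le_mul_of_nonneg_right ?_ (by positivity)
              calc (2 : ℝ) ^ k ≤ 2 ^ 4 := pow_le_pow_right₀ (by norm_num) (by omega)
                _ = 16 := by norm_num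
      · exact (hA (by omega) j h m θ hθ x).trans (le_max_left _ _)
  obtain ⟨A, hA0, hA⟩ := main 4
  refine ⟨A, hA0, fun m θ hθ => ⟨hcd θ m, fun k hk x => ?_⟩⟩
  rw [mul_one]
  exact hA le_rfl k hk m θ hθ x

/-- A factor equal to `ε` near `|ξ| = m` and to `1` away from there. -/
def dip (ε m ξ : ℝ) : ℝ := 1 - (1 - ε) * bumpPair m ξ

lemma dip_neg (ε m ξ : ℝ) : dip ε m (-ξ) = dip ε m ξ := by simp [dip, bumpPair_neg]

lemma dip_eq_one {ε m ξ : ℝ} (hm : 2 ≤ m) (h : 2 ≤ |(|ξ| - m)|) : dip ε m ξ = 1 := by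
  rw [dip, bumpPair_eq hm, bump_eq_zero h]; ring

lemma dip_eq {ε m ξ : ℝ} (hm : 2 ≤ m) (h : |(|ξ| - m)| ≤ 1) : dip ε m ξ = ε := by
  rw [dip, bumpPair_eq hm, bump_eq_one h]; ring

lemma le_dip {ε m : ℝ} (hε : ε ≤ 1) (hm : 2 ≤ m) (ξ : ℝ) : ε ≤ dip ε m ξ := by
  rw [dip, bumpPair_eq hm]
  nlinarith [bump_le_one (|ξ| - m)]

lemma dip_le_one {ε m : ℝ} (hε : ε ≤ 1) (hm : 2 ≤ m) (ξ : ℝ) : dip ε m ξ ≤ 1 := by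
  rw [dip, bumpPair_eq hm]
  nlinarith [bump_nonneg (|ξ| - m)]

lemma exists_symbolBound_dip : ∃ A, 0 ≤ A ∧ ∀ m ε, 0 ≤ ε → ε ≤ 1 →
    SymbolBound (fun _ => 1) A (fun ξ => (dip ε m ξ : ℂ)) := by
  obtain ⟨A, hA, h⟩ := exists_symbolBound_bumpPair
  refine ⟨1 + A, by positivity, fun m ε h0 h1 => ?_⟩
  have := (SymbolBound.const 1).sub ((h m).const_mul ((1 - ε : ℝ) : ℂ))
  have e : (fun ξ => (dip ε m ξ : ℂ)) = fun ξ => 1 - ((1 - ε : ℝ) : ℂ) * (bumpPair m ξ : ℂ) := by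
    ext ξ; simp [dip]
  rw [e]
  refine this.mono fun x => ?_
  rw [Complex.norm_real, Real.norm_of_nonneg (by linarith)]
  simp
  nlinarith

/-- The part of the characteristic function which is subject to the dip and the twist. -/
def carrier (β ε θ m ξ : ℝ) : ℂ := japanese β ξ * dip ε m ξ * twist θ m ξ

lemma exists_symbolBound_carrier (β : ℝ) : ∃ A, 0 ≤ A ∧ ∀ m ε θ, 0 ≤ ε → ε ≤ 1 →
    |θ| ≤ 2 * Real.pi → SymbolBound (japanese β) A (carrier β ε θ m) := by
  obtain ⟨A₁, h₁, H₁⟩ := exists_symbolBound_japanese β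
  obtain ⟨A₂, h₂, H₂⟩ := exists_symbolBound_dip
  obtain ⟨A₃, h₃, H₃⟩ := exists_symbolBound_twist (2 * Real.pi) (by positivity)
  refine ⟨16 * (16 * A₁ * A₂) * A₃, by positivity, fun m ε θ h0 h1 hθ => ?_⟩
  have := (H₁.mul (H₂ m ε h0 h1)).mul (H₃ m θ hθ)
  simp only [mul_one] at this
  exact this

/-! ### Two-point lower bound for product measures -/

/-- The two inequalities between measures confine the Radon–Nikodym derivative to `[1 - e, 1 + e]`
almost everywhere. -/
lemma exists_density_of_le {P Q : Measure ℝ} [IsProbabilityMeasure P] [IsProbabilityMeasure Q]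
    {e : ℝ} (he0 : 0 ≤ e) (hle : Q ≤ P + ENNReal.ofReal e • P)
    (hge : P ≤ Q + ENNReal.ofReal e • P) :
    ∃ L : ℝ → ℝ, Measurable L ∧ (∀ x, |L x - 1| ≤ e) ∧
      P.withDensity (fun x => ENNReal.ofReal (L x)) = Q := by
  have hac : Q ≪ P := by
    refine Measure.AbsolutelyContinuous.mk fun s _ h => le_antisymm ((hle s).trans ?_) zero_le
    simp [h]
  have hup : ∀ᵐ x ∂P, Q.rnDeriv P x ≤ ENNReal.ofReal (1 + e) := by
    refine ae_le_of_forall_setLIntegral_le_of_sigmaFinite (Measure.measurable_rnDeriv _ _)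
      fun s hs _ => ?_
    refine (Measure.setLIntegral_rnDeriv_le s).trans ((hle s).trans ?_)
    rw [setLIntegral_const, ENNReal.ofReal_add zero_le_one he0]
    simp [add_mul]
  have hlow : ∀ᵐ x ∂P, ENNReal.ofReal (1 - e) ≤ Q.rnDeriv P x := by
    refine ae_le_of_forall_setLIntegral_le_of_sigmaFinite measurable_const fun s hs _ => ?_
    rw [Measure.setLIntegral_rnDeriv hac, setLIntegral_const, ENNReal.ofReal_sub _ he0,
      ENNReal.ofReal_one, ENNReal.sub_mul (fun _ _ => measure_ne_top _ _), one_mul,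
      tsub_le_iff_right]
    exact hge s
  -- Truncation makes the bounds hold at every point without changing the derivative almost
  -- everywhere.
  refine ⟨fun x => max (1 - e) (min (1 + e) (Q.rnDeriv P x).toReal), ?_, fun x => ?_, ?_⟩
  · exact measurable_const.max (measurable_const.min (Measure.measurable_rnDeriv _ _).ennreal_toReal)
  · rw [abs_le]
    constructor
    · linarith [le_max_left (1 - e) (min (1 + e) (Q.rnDeriv P x).toReal)]
    · have := max_le (by linarith : 1 - e ≤ 1 + e)
        (min_le_left (1 + e) (Q.rnDeriv P x).toReal)
      linarith
  · rw [← Measure.withDensity_rnDeriv_eq Q P hac]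
    refine withDensity_congr_ae ?_
    rw [Measure.withDensity_rnDeriv_eq Q P hac]
    filter_upwards [hup, hlow] with x h1 h2
    have hfin : Q.rnDeriv P x ≠ ∞ := ne_top_of_le_ne_top ENNReal.ofReal_ne_top h1
    have h1' : (Q.rnDeriv P x).toReal ≤ 1 + e :=
      ENNReal.toReal_le_of_le_ofReal (by linarith) h1
    have h2' : 1 - e ≤ (Q.rnDeriv P x).toReal :=
      (ENNReal.ofReal_le_iff_le_toReal hfin).1 h2
    rw [min_eq_right h1', max_eq_right h2', ENNReal.ofReal_toReal hfin]

lemma lintegral_pi_ofReal_prod {n : ℕ} {L : ℝ → ℝ} (hL : Measurable L) {B : ℝ}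
    (h0 : ∀ x, 0 ≤ L x) (hB : ∀ x, L x ≤ B) (μ : Fin n → Measure ℝ) [∀ i, IsFiniteMeasure (μ i)] :
    ∫⁻ y, ENNReal.ofReal (∏ i, L (y i)) ∂(Measure.pi μ) =
      ∏ i, ∫⁻ x, ENNReal.ofReal (L x) ∂(μ i) := by
  have hint : ∀ i, Integrable L (μ i) := fun i =>
    Integrable.of_bound hL.aestronglyMeasurable B (ae_of_all _ fun x => by
      rw [Real.norm_of_nonneg (h0 x)]; exact hB x)
  have hmeas : Measurable fun y : Fin n → ℝ => ∏ i, L (y i) :=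
    Finset.measurable_fun_prod _ fun i _ => hL.comp (measurable_pi_apply i)
  have hint' : Integrable (fun y : Fin n → ℝ => ∏ i, L (y i)) (Measure.pi μ) :=
    Integrable.of_bound hmeas.aestronglyMeasurable (B ^ n) (ae_of_all _ fun y => by
      rw [Real.norm_of_nonneg (Finset.prod_nonneg fun i _ => h0 _)]
      calc ∏ i, L (y i) ≤ ∏ _i : Fin n, B :=
            Finset.prod_le_prod (fun i _ => h0 _) fun i _ => hB _
        _ = B ^ n := by simp)
  rw [← ofReal_integral_eq_lintegral_ofReal hint'
    (ae_of_all _ fun y => Finset.prod_nonneg fun i _ => h0 _),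
    integral_fintype_prod_eq_prod (f := fun _ x => L x),
    ENNReal.ofReal_prod_of_nonneg fun i _ => integral_nonneg h0]
  exact Finset.prod_congr rfl fun i _ =>
    ofReal_integral_eq_lintegral_ofReal (hint i) (ae_of_all _ h0)

lemma pi_withDensity_prod {n : ℕ} {P Q : Measure ℝ} [IsProbabilityMeasure P]
    [IsProbabilityMeasure Q] {L : ℝ → ℝ} (hL : Measurable L) {B : ℝ}
    (h0 : ∀ x, 0 ≤ L x) (hB : ∀ x, L x ≤ B)
    (hQ : P.withDensity (fun x => ENNReal.ofReal (L x)) = Q) :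
    Measure.pi (fun _ : Fin n => Q) = (Measure.pi (fun _ : Fin n => P)).withDensity
      (fun y => ENNReal.ofReal (∏ i, L (y i))) := by
  refine Measure.pi_eq fun s hs => ?_
  rw [withDensity_apply _ (MeasurableSet.univ_pi hs), Measure.restrict_pi_pi,
    lintegral_pi_ofReal_prod hL h0 hB]
  refine Finset.prod_congr rfl fun i _ => ?_
  rw [← hQ, withDensity_apply _ (hs i)]

/-- The likelihood ratio of two product measures whose factors are within a factor `1 ± e` has
second moment at most `exp (n e²)`. -/
lemma pi_apply_le {n : ℕ} {P Q : Measure ℝ} [IsProbabilityMeasure P] [IsProbabilityMeasure Q]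
    {e M : ℝ} (he0 : 0 ≤ e) (he1 : e ≤ 1) (hle : Q ≤ P + ENNReal.ofReal e • P)
    (hge : P ≤ Q + ENNReal.ofReal e • P) (hM : Real.exp (n * e ^ 2) ≤ M) {S : Set (Fin n → ℝ)}
    (hS : MeasurableSet S) :
    Measure.pi (fun _ : Fin n => Q) S ≤
      ENNReal.ofReal (1 / 4) + ENNReal.ofReal M * Measure.pi (fun _ : Fin n => P) S := by
  obtain ⟨L, hL, hLe, hQ⟩ := exists_density_of_le he0 hle hge
  have hM0 : 0 < M := (Real.exp_pos _).trans_le hM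
  have h0 : ∀ x, 0 ≤ L x := fun x => by linarith [(abs_le.1 (hLe x)).1]
  have hB : ∀ x, L x ≤ 2 := fun x => by linarith [(abs_le.1 (hLe x)).2]
  have hintL : Integrable L P := Integrable.of_bound hL.aestronglyMeasurable 2
    (ae_of_all _ fun x => by rw [Real.norm_of_nonneg (h0 x)]; exact hB x)
  have hone : ∫ x, L x ∂P = 1 := by
    rw [integral_eq_lintegral_of_nonneg_ae (ae_of_all _ h0) hL.aestronglyMeasurable]
    have : ∫⁻ x, ENNReal.ofReal (L x) ∂P = Q Set.univ := by
      rw [← hQ, withDensity_apply _ MeasurableSet.univ, setLIntegral_univ]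
    rw [this]; simp
  have hsq : ∫ x, L x ^ 2 ∂P ≤ 1 + e ^ 2 := by
    -- This is `L² = 2 L - 1 + (L - 1)²`; since `L` integrates to `1`, the second moment is at most
    -- `1 + e²`.
    have hpt : ∀ x, L x ^ 2 ≤ 2 * L x - 1 + e ^ 2 := fun x => by
      have := sq_le_sq' (abs_le.1 (hLe x)).1 (abs_le.1 (hLe x)).2
      nlinarith
    have hi : Integrable (fun x => 2 * L x - 1 + e ^ 2) P :=
      ((hintL.const_mul 2).sub (integrable_const 1)).add (integrable_const _)
    refine (integral_mono_of_nonneg (ae_of_all _ fun x => sq_nonneg _) hi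
      (ae_of_all _ hpt)).trans_eq ?_
    have e1 : ∫ x, (2 * L x - 1 + e ^ 2) ∂P = ∫ x, (2 * L x - 1) ∂P + ∫ _x, e ^ 2 ∂P :=
      integral_add ((hintL.const_mul 2).sub (integrable_const 1)) (integrable_const _)
    have e2 : ∫ x, (2 * L x - 1) ∂P = ∫ x, 2 * L x ∂P - ∫ _x, (1 : ℝ) ∂P :=
      integral_sub (hintL.const_mul 2) (integrable_const 1)
    rw [e1, e2, integral_const_mul, hone]
    simp
    norm_num
  have hLsq : ∫⁻ y, ENNReal.ofReal (∏ i, L (y i) ^ 2) ∂(Measure.pi fun _ : Fin n => P) ≤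
      ENNReal.ofReal M := by
    rw [lintegral_pi_ofReal_prod (L := fun x => L x ^ 2) (hL.pow_const 2) (B := 4)
      (fun x => sq_nonneg _) (fun x => by nlinarith [h0 x, hB x]), Finset.prod_const,
      ← ofReal_integral_eq_lintegral_ofReal]
    · rw [← ENNReal.ofReal_pow (integral_nonneg fun x => sq_nonneg _)]
      refine ENNReal.ofReal_le_ofReal (le_trans ?_ hM)
      rw [Finset.card_fin, Real.exp_nat_mul]
      refine pow_le_pow_left₀ (integral_nonneg fun x => sq_nonneg _) (hsq.trans ?_) n
      linarith [Real.add_one_le_exp (e ^ 2)]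
    · exact Integrable.of_bound (hL.pow_const 2).aestronglyMeasurable 4 (ae_of_all _ fun x => by
        rw [Real.norm_of_nonneg (sq_nonneg _)]; nlinarith [h0 x, hB x])
    · exact ae_of_all _ fun x => sq_nonneg _
  have hmeas : Measurable fun y : Fin n → ℝ => ∏ i, L (y i) ^ 2 :=
    Finset.measurable_fun_prod _ fun i _ => (hL.pow_const 2).comp (measurable_pi_apply i)
  rw [pi_withDensity_prod hL h0 hB hQ, withDensity_apply _ hS]
  calc ∫⁻ y in S, ENNReal.ofReal (∏ i, L (y i)) ∂(Measure.pi fun _ : Fin n => P)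
      ≤ ∫⁻ y in S, (ENNReal.ofReal (1 / (4 * M)) * ENNReal.ofReal (∏ i, L (y i) ^ 2) +
          ENNReal.ofReal M) ∂(Measure.pi fun _ : Fin n => P) := by
        refine lintegral_mono fun y => ?_
        rw [← ENNReal.ofReal_mul (by positivity), ← ENNReal.ofReal_add
          (mul_nonneg (by positivity) (Finset.prod_nonneg fun i _ => sq_nonneg _)) hM0.le]
        refine ENNReal.ofReal_le_ofReal ?_
        rw [Finset.prod_pow]
        set z := ∏ i, L (y i)
        -- The inequality `z ≤ z² / (4M) + M`: the quadratic term integrates to at most `1/4`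
        -- because the second moment of `z` is at most `M`.
        have : 1 / (4 * M) * z ^ 2 + M - z = (z - 2 * M) ^ 2 / (4 * M) := by
          field_simp; ring
        have h2 : 0 ≤ (z - 2 * M) ^ 2 / (4 * M) := by positivity
        linarith
    _ = ENNReal.ofReal (1 / (4 * M)) * ∫⁻ y in S, ENNReal.ofReal (∏ i, L (y i) ^ 2)
          ∂(Measure.pi fun _ : Fin n => P) +
          ENNReal.ofReal M * Measure.pi (fun _ : Fin n => P) S := by
        rw [lintegral_add_right _ measurable_const, lintegral_const_mul _ hmeas.ennreal_ofReal,
          setLIntegral_const]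
    _ ≤ _ := by
        gcongr
        calc _ ≤ ENNReal.ofReal (1 / (4 * M)) * ENNReal.ofReal M := by
              gcongr
              exact (setLIntegral_le_lintegral _ _).trans hLsq
          _ = ENNReal.ofReal (1 / 4) := by
              rw [← ENNReal.ofReal_mul (by positivity)]
              congr 1; field_simp

/-- **Le Cam's two-point bound** for product measures whose factors are close to each other. -/
lemma two_point_bound {n : ℕ} {P Q : Measure ℝ} [IsProbabilityMeasure P] [IsProbabilityMeasure Q]
    {e M : ℝ} (he0 : 0 ≤ e) (he1 : e ≤ 1) (hle : Q ≤ P + ENNReal.ofReal e • P)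
    (hge : P ≤ Q + ENNReal.ofReal e • P) (hM : Real.exp (n * e ^ 2) ≤ M)
    {A₀ A₁ : (Fin n → ℝ) → ℝ≥0∞} (h₁ : Measurable A₁) {D : ℝ}
    (hD : 0 ≤ D) (hsum : ∀ y, ENNReal.ofReal D ≤ A₀ y + A₁ y) {r : ℝ≥0∞}
    (hr₀ : ∫⁻ y, A₀ y ∂(Measure.pi fun _ : Fin n => P) ≤ r)
    (hr₁ : ∫⁻ y, A₁ y ∂(Measure.pi fun _ : Fin n => Q) ≤ r) :
    ENNReal.ofReal (3 * D / (8 * (1 + M))) ≤ r := by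
  have hM0 : 0 < M := (Real.exp_pos _).trans_le hM
  set E : Set (Fin n → ℝ) := {y | ENNReal.ofReal (D / 2) ≤ A₁ y} with hE
  have hEm : MeasurableSet E := measurableSet_le measurable_const h₁
  have b₁ : ENNReal.ofReal (D / 2) * Measure.pi (fun _ : Fin n => Q) E ≤ r := by
    refine le_trans ?_ hr₁
    rw [← setLIntegral_const]
    refine le_trans (setLIntegral_mono h₁ fun y hy => hy) (setLIntegral_le_lintegral _ _)
  have b₀ : ENNReal.ofReal (D / 2) * Measure.pi (fun _ : Fin n => P) Eᶜ ≤ r := by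
    refine le_trans ?_ hr₀
    rw [← setLIntegral_const]
    refine le_trans (setLIntegral_mono' hEm.compl fun y hy => ?_) (setLIntegral_le_lintegral _ _)
    by_contra hlt
    rw [not_le] at hlt
    have hy' : A₁ y < ENNReal.ofReal (D / 2) := not_le.1 hy
    have := ENNReal.add_lt_add hlt hy'
    rw [← ENNReal.ofReal_add (by positivity) (by positivity), add_halves] at this
    exact absurd (hsum y) (not_le.2 this)
  by_cases hrt : r = ∞
  · simp [hrt]
  -- With `E` the event that the loss under `Q` is at least `D/2`, this gives `3/4 ≤ Q(E) + M
  -- P(Eᶜ)`. On `Eᶜ` the loss under `P` is at least `D/2`, so `3D/8 ≤ (1 + M) r`.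
  have key := pi_apply_le he0 he1 hle hge hM hEm.compl
  have q1 : Measure.pi (fun _ : Fin n => Q) E + Measure.pi (fun _ : Fin n => Q) Eᶜ = 1 := by
    rw [measure_add_measure_compl hEm, measure_univ]
  set qE := (Measure.pi (fun _ : Fin n => Q) E) with hqE
  set qc := (Measure.pi (fun _ : Fin n => Q) Eᶜ)
  set pc := (Measure.pi (fun _ : Fin n => P) Eᶜ)
  have fq : qE ≠ ∞ := measure_ne_top _ _
  have fqc : qc ≠ ∞ := measure_ne_top _ _
  have fp : pc ≠ ∞ := measure_ne_top _ _
  have q1' : qE.toReal + qc.toReal = 1 := by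
    rw [← ENNReal.toReal_add fq fqc, q1]; simp
  have key' : qc.toReal ≤ 1 / 4 + M * pc.toReal := by
    have := ENNReal.toReal_mono (by finiteness) key
    rwa [ENNReal.toReal_add (by finiteness) (by finiteness), ENNReal.toReal_mul,
      ENNReal.toReal_ofReal (by norm_num), ENNReal.toReal_ofReal hM0.le] at this
  have b₁' : D / 2 * qE.toReal ≤ r.toReal := by
    have := ENNReal.toReal_mono hrt b₁
    rwa [ENNReal.toReal_mul, ENNReal.toReal_ofReal (by positivity)] at this
  have b₀' : D / 2 * pc.toReal ≤ r.toReal := by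
    have := ENNReal.toReal_mono hrt b₀
    rwa [ENNReal.toReal_mul, ENNReal.toReal_ofReal (by positivity)] at this
  refine ENNReal.ofReal_le_of_le_toReal ?_
  rw [div_le_iff₀ (by positivity)]
  have h1 : M * (D / 2 * pc.toReal) ≤ M * r.toReal := mul_le_mul_of_nonneg_left b₀' hM0.le
  have h2 : D / 2 * (3 / 4) ≤ D / 2 * (qE.toReal + M * pc.toReal) :=
    mul_le_mul_of_nonneg_left (by linarith) (by positivity)
  nlinarith

/-! ### Laws of sums -/

lemma IsDensity.isProbabilityMeasure {f : ℝ → ℝ} (hf : IsDensity f) :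
    IsProbabilityMeasure (law f) :=
  ⟨by rw [law, withDensity_apply _ MeasurableSet.univ, setLIntegral_univ, hf.mass_one]⟩

lemma isProbabilityMeasure_aggregatedLaw (K : ℕ) {f : ℝ → ℝ} (hf : IsDensity f) :
    IsProbabilityMeasure (aggregatedLaw K f) := by
  have := hf.isProbabilityMeasure
  exact Measure.isProbabilityMeasure_map
    (Finset.measurable_fun_sum _ fun i _ => measurable_pi_apply i).aemeasurable

lemma charFun_aggregatedLaw (K : ℕ) {f : ℝ → ℝ} (hf : IsDensity f) (u : ℝ) :
    charFun (aggregatedLaw K f) u = charFun (law f) u ^ K := by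
  have := hf.isProbabilityMeasure
  rw [aggregatedLaw, ProbabilityTheory.charFun_map_sum_pi_eq_prod]
  simp

lemma aggregatedLaw_succ (K : ℕ) {f : ℝ → ℝ} (hf : IsDensity f) :
    aggregatedLaw (K + 1) f = Measure.conv (aggregatedLaw K f) (law f) := by
  have := hf.isProbabilityMeasure
  have := isProbabilityMeasure_aggregatedLaw K hf
  have := isProbabilityMeasure_aggregatedLaw (K + 1) hf
  refine Measure.ext_of_charFun (funext fun u => ?_)
  rw [charFun_conv, charFun_aggregatedLaw _ hf, charFun_aggregatedLaw _ hf, pow_succ]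

/-- The measure with Lebesgue density `tail`. -/
def tailMeasure : Measure ℝ := volume.withDensity fun x => ENNReal.ofReal (tail x)

lemma measurable_ofReal_tail : Measurable fun x => ENNReal.ofReal (tail x) :=
  continuous_tail.measurable.ennreal_ofReal

/-- By `tail_mul_le`, a translate by `y` of the density is at least `(c/4) tail y * tail x`;
integrating over `y` keeps the tail and yields the constant. -/
lemma tailMeasure_le_conv {c : ℝ} {f : ℝ → ℝ} (hf : IsDensity f)
    (hc : ∀ x, c * tail x ≤ f x) (hc0 : 0 ≤ c) (ν : Measure ℝ) [IsProbabilityMeasure ν] :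
    (ENNReal.ofReal (c / 4) * ∫⁻ x, ENNReal.ofReal (tail x) ∂ν) • tailMeasure ≤
      Measure.conv ν (law f) := by
  have := hf.isProbabilityMeasure
  refine Measure.le_iff.2 fun S hS => ?_
  rw [← lintegral_indicator_one hS (μ := Measure.conv ν (law f)),
    Measure.lintegral_conv (measurable_one.indicator hS)]
  have hinner : ∀ y, ENNReal.ofReal (tail y) * (ENNReal.ofReal (c / 4) * tailMeasure S) ≤
      ∫⁻ x, S.indicator 1 (y + x) ∂(law f) := by
    intro y
    rw [law, lintegral_withDensity_eq_lintegral_mul _ hf.measurable.ennreal_ofReal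
      (g := fun x => S.indicator 1 (y + x))
      ((measurable_one.indicator hS).comp (measurable_const_add y))]
    have e : ∫⁻ x, ((fun x => ENNReal.ofReal (f x)) * (fun x => S.indicator 1 (y + x)) :
        ℝ → ℝ≥0∞) x =
        ∫⁻ x, ENNReal.ofReal (f (x - y)) * S.indicator 1 x := by
      rw [← lintegral_add_left_eq_self (fun x => ENNReal.ofReal (f (x - y)) * S.indicator 1 x) y]
      simp
    rw [e, tailMeasure, withDensity_apply _ hS, ← lintegral_indicator hS,
      ← lintegral_const_mul _ (measurable_ofReal_tail.indicator hS),
      ← lintegral_const_mul _ ((measurable_ofReal_tail.indicator hS).const_mul _)]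
    refine lintegral_mono fun x => ?_
    by_cases hx : x ∈ S
    · simp only [Set.indicator_of_mem hx, Pi.one_apply, mul_one]
      rw [← ENNReal.ofReal_mul (by positivity), ← ENNReal.ofReal_mul (tail_pos y).le]
      refine ENNReal.ofReal_le_ofReal ?_
      nlinarith [tail_mul_le x y, hc (x - y)]
    · simp [Set.indicator_of_notMem hx]
  refine le_trans (le_of_eq ?_) (lintegral_mono hinner)
  rw [lintegral_mul_const _ measurable_ofReal_tail]
  simp only [Measure.smul_apply, smul_eq_mul]
  ring

/-- Induction on the number of summands. The lower bound on the integral of `tail` feeds the next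
convolution; it is also meaningful for the empty sum, a Dirac mass, where domination of
`tailMeasure` fails. The constant depends on `c` and `K` only, not on `f`. -/
lemma exists_tailMeasure_le_aggregatedLaw {c : ℝ} (hc0 : 0 < c) (K : ℕ) :
    ∃ e : ℝ, 0 < e ∧ ∀ f : ℝ → ℝ, IsDensity f → (∀ x, c * tail x ≤ f x) →
      (ENNReal.ofReal e ≤ ∫⁻ x, ENNReal.ofReal (tail x) ∂(aggregatedLaw K f)) ∧
      (K ≠ 0 → ENNReal.ofReal e • tailMeasure ≤ aggregatedLaw K f) := by
  have hI : 0 < ∫ x, tail x ^ 2 := by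
    rw [integral_pos_iff_support_of_nonneg (fun x => sq_nonneg _) integrable_tail_sq]
    have : Function.support (fun x => tail x ^ 2) = Set.univ := by
      ext x; simp [(tail_pos x).ne']
    simp [this]
  have hsq : ∫⁻ x, ENNReal.ofReal (tail x) ∂tailMeasure = ENNReal.ofReal (∫ x, tail x ^ 2) := by
    rw [tailMeasure, lintegral_withDensity_eq_lintegral_mul _ measurable_ofReal_tail
      measurable_ofReal_tail, ofReal_integral_eq_lintegral_ofReal]
    · refine lintegral_congr fun x => ?_
      rw [Pi.mul_apply, ← ENNReal.ofReal_mul (tail_pos x).le, sq]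
    · by_contra h
      rw [integral_undef h] at hI
      exact lt_irrefl _ hI
    · exact ae_of_all _ fun x => sq_nonneg _
  induction K with
  | zero =>
    refine ⟨1, one_pos, fun f hf _ => ⟨?_, fun h => absurd rfl h⟩⟩
    have : aggregatedLaw 0 f = Measure.dirac 0 := by
      have := hf.isProbabilityMeasure
      have := isProbabilityMeasure_aggregatedLaw 0 hf
      refine Measure.ext_of_charFun (funext fun u => ?_)
      rw [charFun_aggregatedLaw _ hf]
      simp [charFun_dirac]
    rw [this, lintegral_dirac' _ measurable_ofReal_tail]
    simp [tail]
  | succ K ih =>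
    obtain ⟨e, he, h⟩ := ih
    set e₁ := c / 4 * e with he₁
    have he₁0 : 0 < e₁ := by positivity
    set J := ∫ x, tail x ^ 2
    refine ⟨min e₁ (e₁ * J), by positivity, fun f hf hcf => ?_⟩
    have := isProbabilityMeasure_aggregatedLaw K hf
    have main : ENNReal.ofReal e₁ • tailMeasure ≤ aggregatedLaw (K + 1) f := by
      rw [aggregatedLaw_succ K hf]
      refine le_trans ?_ (tailMeasure_le_conv hf hcf hc0.le (aggregatedLaw K f))
      refine Measure.le_iff.2 fun S _ => ?_
      simp only [Measure.smul_apply, smul_eq_mul]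
      gcongr
      rw [he₁, ENNReal.ofReal_mul (by positivity)]
      gcongr
      exact (h f hf hcf).1
    constructor
    · calc ENNReal.ofReal (min e₁ (e₁ * J)) ≤ ENNReal.ofReal (e₁ * J) :=
            ENNReal.ofReal_le_ofReal (min_le_right _ _)
        _ = ∫⁻ x, ENNReal.ofReal (tail x) ∂(ENNReal.ofReal e₁ • tailMeasure) := by
            rw [lintegral_smul_measure, hsq, smul_eq_mul, ENNReal.ofReal_mul he₁0.le]
        _ ≤ _ := lintegral_mono' main le_rfl
    · intro _
      refine le_trans ?_ main
      refine Measure.le_iff.2 fun S _ => ?_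
      simp only [Measure.smul_apply, smul_eq_mul]
      gcongr
      exact min_le_left _ _

/-- Two finite measures whose characteristic functions differ by the Fourier transform of a
function dominated by `η * tail` differ by at most `η • tailMeasure`. -/
lemma le_add_tailMeasure {μ ν : Measure ℝ} [IsFiniteMeasure μ] [IsFiniteMeasure ν] {d : ℝ → ℝ}
    (hd : Continuous d) {η : ℝ} (hη : ∀ x, |d x| ≤ η * tail x) (hη0 : 0 ≤ η)
    (hchar : ∀ u, charFun μ u - charFun ν u = ∫ x : ℝ, Complex.exp (u * x * I) * d x) :
    μ ≤ ν + ENNReal.ofReal η • tailMeasure := by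
  have hdi : Integrable d := (integrable_tail.const_mul η).mono' hd.aestronglyMeasurable
    (ae_of_all _ hη)
  set p : ℝ → ℝ := fun x => max (d x) 0 with hp
  set q : ℝ → ℝ := fun x => max (-d x) 0 with hq
  have hpi : Integrable p := hdi.pos_part
  have hqi : Integrable q := hdi.neg_part
  have hpm : Measurable fun x => ENNReal.ofReal (p x) :=
    (hd.measurable.max measurable_const).ennreal_ofReal
  have hqm : Measurable fun x => ENNReal.ofReal (q x) :=
    (hd.neg.measurable.max measurable_const).ennreal_ofReal
  have fin : ∀ {g : ℝ → ℝ}, Integrable g → IsFiniteMeasure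
      (volume.withDensity fun x => ENNReal.ofReal (g x)) := fun hg =>
    isFiniteMeasure_withDensity_ofReal hg.2
  have := fin hpi
  have := fin hqi
  have hcf : ∀ {g : ℝ → ℝ}, (Measurable fun x => ENNReal.ofReal (g x)) → (∀ x, 0 ≤ g x) → ∀ u,
      charFun (volume.withDensity fun x => ENNReal.ofReal (g x)) u =
        ∫ x : ℝ, Complex.exp (u * x * I) * g x := by
    intro g hgm hg0 u
    rw [charFun_apply_real, integral_withDensity_eq_integral_toReal_smul hgm (by simp)]
    refine integral_congr_ae (ae_of_all _ fun x => ?_)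
    simp [ENNReal.toReal_ofReal (hg0 x), mul_comm]
  have hexp : ∀ {g : ℝ → ℝ}, Integrable g → ∀ u : ℝ,
      Integrable fun x : ℝ => Complex.exp (u * x * I) * (g x : ℂ) := by
    intro g hg u
    refine hg.norm.mono' ?_ (ae_of_all _ fun x => ?_)
    · exact (Continuous.aestronglyMeasurable (by fun_prop)).mul
        (hg.ofReal (𝕜 := ℂ)).aestronglyMeasurable
    · rw [norm_mul, ← Complex.ofReal_mul, Complex.norm_exp_ofReal_mul_I, one_mul, Complex.norm_real]
  -- Moving the negative part of `d` to the other side leaves finite positive measures, to which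
  -- uniqueness of characteristic functions applies.
  have heq : μ + volume.withDensity (fun x => ENNReal.ofReal (q x)) =
      ν + volume.withDensity (fun x => ENNReal.ofReal (p x)) := by
    refine Measure.ext_of_charFun (funext fun u => ?_)
    have hadd : ∀ (α γ : Measure ℝ) [IsFiniteMeasure α] [IsFiniteMeasure γ],
        charFun (α + γ) u = charFun α u + charFun γ u := by
      intro α γ _ _
      simp only [charFun_apply_real]
      have hb : ∀ (α : Measure ℝ) [IsFiniteMeasure α],
          Integrable (fun x : ℝ => Complex.exp (u * x * I)) α := fun α _ =>
        Integrable.of_bound (Continuous.aestronglyMeasurable (by fun_prop)) 1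
          (ae_of_all _ fun x => by
            rw [← Complex.ofReal_mul, Complex.norm_exp_ofReal_mul_I])
      exact integral_add_measure (hb α) (hb γ)
    rw [hadd, hadd, hcf hqm (fun x => le_max_right _ _), hcf hpm (fun x => le_max_right _ _)]
    have : ∫ x : ℝ, Complex.exp (u * x * I) * d x =
        (∫ x : ℝ, Complex.exp (u * x * I) * p x) - ∫ x : ℝ, Complex.exp (u * x * I) * q x := by
      rw [← integral_sub (hexp hpi u) (hexp hqi u)]
      refine integral_congr_ae (ae_of_all _ fun x => ?_)
      simp only [← mul_sub, ← Complex.ofReal_sub]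
      congr 2
      have := max_zero_sub_max_neg_zero_eq_self (d x)
      exact this.symm
    linear_combination hchar u + this
  calc μ ≤ μ + volume.withDensity (fun x => ENNReal.ofReal (q x)) := Measure.le_add_right le_rfl
    _ = ν + volume.withDensity (fun x => ENNReal.ofReal (p x)) := heq
    _ ≤ _ := by
      gcongr
      rw [tailMeasure, ← withDensity_smul _ measurable_ofReal_tail]
      refine withDensity_mono (ae_of_all _ fun x => ?_)
      simp only [Pi.smul_apply, smul_eq_mul]
      rw [← ENNReal.ofReal_mul hη0]
      refine ENNReal.ofReal_le_ofReal (max_le ((le_abs_self _).trans (hη x)) ?_)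
      exact mul_nonneg hη0 (tail_pos x).le

/-! ### Densities comparable to `tail` and their rescalings -/

/-- `g` is continuous, lies between `c * tail` and `C * tail`, and its inverse Fourier transform
is `W`, with `W 0 = 1`. -/
structure Profile (c C : ℝ) (g : ℝ → ℝ) (W : ℝ → ℂ) : Prop where
  continuous : Continuous g
  lower : ∀ x, c * tail x ≤ g x
  upper : ∀ x, g x ≤ C * tail x
  fourierInv : ∀ ξ : ℝ, ∫ x : ℝ, Complex.exp (((2 * Real.pi * x * ξ : ℝ) : ℂ) * I) * g x = W ξ
  map_zero : W 0 = 1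

/-- The density of `t X`, where `X` has density `g`. -/
def scaled (t : ℝ) (g : ℝ → ℝ) (x : ℝ) : ℝ := g (x / t) / t

namespace Profile

variable {c C t : ℝ} {g : ℝ → ℝ} {W : ℝ → ℂ}

lemma nonneg (h : Profile c C g W) (hc : 0 < c) (x : ℝ) : 0 ≤ g x :=
  (mul_pos hc (tail_pos x)).le.trans (h.lower x)

lemma integrable (h : Profile c C g W) (hc : 0 < c) : Integrable g :=
  (integrable_tail.const_mul C).mono' h.continuous.aestronglyMeasurable (ae_of_all _ fun x => by
    rw [Real.norm_of_nonneg (h.nonneg hc x)]; exact h.upper x)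

lemma integral_eq_one (h : Profile c C g W) : ∫ x, g x = 1 := by
  have := h.fourierInv 0
  simp only [mul_zero, ofReal_zero, zero_mul, Complex.exp_zero, one_mul, h.map_zero] at this
  rw [integral_complex_ofReal] at this
  exact_mod_cast this

lemma continuous_scaled (h : Profile c C g W) : Continuous (scaled t g) :=
  (h.continuous.comp (continuous_id.div_const t)).div_const t

lemma integral_scaled_mul {E : Type*} [NormedAddCommGroup E] [NormedSpace ℝ E] (ht : 0 < t)
    (g : ℝ → ℝ) (φ : ℝ → E) : ∫ x, scaled t g x • φ x = ∫ y, g y • φ (t * y) := by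
  have := Measure.integral_comp_div (fun y => (g y / t) • φ (t * y)) t
  have e : (fun x => scaled t g x • φ x) = fun x => (g (x / t) / t) • φ (t * (x / t)) := by
    ext x; rw [scaled, mul_div_cancel₀ _ ht.ne']
  rw [e, this, abs_of_pos ht, ← integral_smul]
  refine integral_congr_ae (ae_of_all _ fun y => ?_)
  simp only [smul_smul]
  congr 1
  field_simp

lemma integrable_scaled (h : Profile c C g W) (hc : 0 < c) (ht : 0 < t) :
    Integrable (scaled t g) :=
  ((h.integrable hc).comp_div ht.ne').div_const t

lemma scaled_nonneg (h : Profile c C g W) (hc : 0 < c) (ht : 0 < t) (x : ℝ) :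
    0 ≤ scaled t g x := div_nonneg (h.nonneg hc _) ht.le

lemma isDensity (h : Profile c C g W) (hc : 0 < c) (ht : 0 < t) : IsDensity (scaled t g) := by
  refine ⟨h.continuous_scaled.measurable, h.scaled_nonneg hc ht, ?_⟩
  rw [← ofReal_integral_eq_lintegral_ofReal (h.integrable_scaled hc ht)
    (ae_of_all _ (h.scaled_nonneg hc ht))]
  have := integral_scaled_mul ht g fun _ => (1 : ℝ)
  simp only [smul_eq_mul, mul_one] at this
  rw [this, h.integral_eq_one, ENNReal.ofReal_one]

lemma charFun_law (h : Profile c C g W) (hc : 0 < c) (ht : 0 < t) (u : ℝ) :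
    charFun (law (scaled t g)) u = W (t / (2 * Real.pi) * u) := by
  rw [charFun_apply_real, law, integral_withDensity_eq_integral_toReal_smul
    h.continuous_scaled.measurable.ennreal_ofReal (by simp)]
  simp only [ENNReal.toReal_ofReal (h.scaled_nonneg hc ht _)]
  rw [integral_scaled_mul ht g fun x : ℝ => Complex.exp (u * x * I), ← h.fourierInv]
  refine integral_congr_ae (ae_of_all _ fun y => ?_)
  simp only [Complex.real_smul]
  rw [mul_comm]
  congr 3
  have : (Real.pi : ℂ) ≠ 0 := by exact_mod_cast Real.pi_ne_zero
  push_cast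
  field_simp

lemma lintegral_sq_le (h : Profile c C g W) (hc : 0 < c) (ht : 0 < t) :
    ∫⁻ x, ENNReal.ofReal (x ^ 2) ∂(law (scaled t g)) ≤
      ENNReal.ofReal (t ^ 2 * (C * ∫ x, x ^ 2 * tail x)) := by
  rw [law, lintegral_withDensity_eq_lintegral_mul _ h.continuous_scaled.measurable.ennreal_ofReal
    (g := fun x : ℝ => ENNReal.ofReal (x ^ 2)) (measurable_id.pow_const 2).ennreal_ofReal]
  have e : ∀ x : ℝ, ((fun x => ENNReal.ofReal (scaled t g x)) *
      (fun x => ENNReal.ofReal (x ^ 2)) : ℝ → ℝ≥0∞) x =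
      ENNReal.ofReal (scaled t g x * x ^ 2) := fun x => by
    rw [Pi.mul_apply, ← ENNReal.ofReal_mul (h.scaled_nonneg hc ht x)]
  have hi2 : Integrable fun x => g x * x ^ 2 := by
    refine (integrable_sq_mul_tail.const_mul C).mono'
      (h.continuous.mul (continuous_id.pow 2)).aestronglyMeasurable (ae_of_all _ fun x => ?_)
    rw [Real.norm_of_nonneg (mul_nonneg (h.nonneg hc x) (sq_nonneg x))]
    nlinarith [h.upper x, sq_nonneg x]
  have hi : Integrable fun x => scaled t g x * x ^ 2 := by
    have := (hi2.comp_div ht.ne').const_mul t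
    refine this.congr (ae_of_all _ fun x => ?_)
    simp only [scaled]
    field_simp
  simp_rw [e]
  rw [← ofReal_integral_eq_lintegral_ofReal hi
    (ae_of_all _ fun x => mul_nonneg (h.scaled_nonneg hc ht x) (sq_nonneg x))]
  refine ENNReal.ofReal_le_ofReal ?_
  have := integral_scaled_mul ht g fun x : ℝ => x ^ 2
  simp only [smul_eq_mul] at this
  rw [this, ← integral_const_mul, ← integral_const_mul]
  have hm : ∀ x, g x * (t * x) ^ 2 ≤ t ^ 2 * (C * (x ^ 2 * tail x)) := fun x => by
    calc g x * (t * x) ^ 2 ≤ (C * tail x) * (t * x) ^ 2 :=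
          mul_le_mul_of_nonneg_right (h.upper x) (sq_nonneg _)
      _ = _ := by ring
  refine integral_mono_of_nonneg (ae_of_all _ fun x => mul_nonneg (h.nonneg hc x) (sq_nonneg _))
    ((integrable_sq_mul_tail.const_mul C).const_mul _) (ae_of_all _ hm)

lemma eLpNorm_le (h : Profile c C g W) (hc : 0 < c) (ht : 0 < t) {B : ℝ}
    (hB0 : 0 ≤ B) (hB : C ^ 2 * (∫ x, tail x ^ 2) / t ≤ B ^ 2) :
    eLpNorm (scaled t g) 2 volume ≤ ENNReal.ofReal B := by
  have hi2 : Integrable fun x => g x ^ 2 :=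
    (integrable_tail_sq.const_mul (C ^ 2)).mono' (h.continuous.pow 2).aestronglyMeasurable
      (ae_of_all _ fun x => by
        rw [Real.norm_of_nonneg (sq_nonneg _), ← mul_pow]
        exact pow_le_pow_left₀ (h.nonneg hc x) (h.upper x) 2)
  have hi : Integrable fun x => scaled t g x ^ 2 := by
    refine ((hi2.comp_div ht.ne').div_const (t ^ 2)).congr (ae_of_all _ fun x => ?_)
    simp only [scaled, div_pow]
  have hI : ∫ x, scaled t g x ^ 2 ≤ B ^ 2 := by
    have := integral_scaled_mul ht g (scaled t g)
    simp only [smul_eq_mul, ← sq] at this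
    rw [this]
    refine le_trans ?_ hB
    rw [← integral_const_mul, ← integral_div]
    refine integral_mono_of_nonneg
      (ae_of_all _ fun x => mul_nonneg (h.nonneg hc x) (h.scaled_nonneg hc ht _))
      ((integrable_tail_sq.const_mul _).div_const _) (ae_of_all _ fun x => ?_)
    simp only [scaled]
    rw [mul_div_cancel_left₀ _ ht.ne', ← mul_div_assoc, ← sq, ← mul_pow]
    exact div_le_div_of_nonneg_right (pow_le_pow_left₀ (h.nonneg hc x) (h.upper x) 2) ht.le
  rw [eLpNorm_eq_lintegral_rpow_enorm_toReal (by norm_num) (by norm_num)]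
  have e : ∀ x, ‖scaled t g x‖ₑ ^ (2 : ℝ≥0∞).toReal = ENNReal.ofReal (scaled t g x ^ 2) := by
    intro x
    rw [Real.enorm_of_nonneg (h.scaled_nonneg hc ht x), ENNReal.toReal_ofNat,
      ENNReal.ofReal_rpow_of_nonneg (h.scaled_nonneg hc ht x) (by norm_num)]
    norm_cast
  simp_rw [e]
  rw [← ofReal_integral_eq_lintegral_ofReal hi (ae_of_all _ fun x => sq_nonneg _),
    ENNReal.ofReal_rpow_of_nonneg (integral_nonneg fun x => sq_nonneg _) (by positivity)]
  refine ENNReal.ofReal_le_ofReal ?_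
  rw [ENNReal.toReal_ofNat, ← Real.sqrt_eq_rpow]
  exact Real.sqrt_le_iff.2 ⟨hB0, hI⟩

/-- A Lipschitz bound at the origin from the first absolute moment, with `|x| ≤ 1 + x²`. It keeps
the characteristic function above the lower envelope near `0`, where that envelope equals `1`. -/
lemma norm_sub_one_le (h : Profile c C g W) (hc : 0 < c) (ξ : ℝ) :
    ‖W ξ - 1‖ ≤ 2 * Real.pi * C * ((∫ x, tail x) + ∫ x, x ^ 2 * tail x) * |ξ| := by
  have hg := h.integrable hc
  have hint : Integrable fun x : ℝ => Complex.exp (((2 * Real.pi * x * ξ : ℝ) : ℂ) * I) * g x := by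
    refine hg.norm.mono' ?_ (ae_of_all _ fun x => ?_)
    · have := h.continuous
      exact Continuous.aestronglyMeasurable (by fun_prop)
    · rw [norm_mul, Complex.norm_exp_ofReal_mul_I, one_mul, Complex.norm_real]
  have hgC : Integrable fun x => (g x : ℂ) := hg.ofReal
  have e : W ξ - 1 =
      ∫ x : ℝ, (Complex.exp (((2 * Real.pi * x * ξ : ℝ) : ℂ) * I) - 1) * g x := by
    simp only [sub_mul, one_mul]
    rw [integral_sub hint hgC, h.fourierInv, integral_complex_ofReal, h.integral_eq_one]
    simp
  rw [e, ← integral_add integrable_tail integrable_sq_mul_tail]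
  refine (norm_integral_le_integral_norm _).trans ?_
  rw [mul_right_comm, ← integral_const_mul]
  refine integral_mono_of_nonneg (ae_of_all _ fun x => norm_nonneg _)
    ((integrable_tail.add integrable_sq_mul_tail).const_mul _) (ae_of_all _ fun x => ?_)
  simp only [norm_mul, Complex.norm_real, Real.norm_of_nonneg (h.nonneg hc x)]
  have h1 : ‖Complex.exp (((2 * Real.pi * x * ξ : ℝ) : ℂ) * I) - 1‖ ≤
      2 * Real.pi * |ξ| * (1 + x ^ 2) := by
    have := Real.norm_exp_I_mul_ofReal_sub_one_le (x := 2 * Real.pi * x * ξ)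
    rw [mul_comm]
    refine this.trans ?_
    rw [Real.norm_eq_abs, abs_mul, abs_mul, abs_of_pos (by positivity : 0 < 2 * Real.pi)]
    have hx : |x| ≤ 1 + x ^ 2 := by nlinarith [sq_abs x, sq_nonneg (|x| - 1), abs_nonneg x]
    have : 0 ≤ 2 * Real.pi * |ξ| := by positivity
    nlinarith
  calc _ ≤ (2 * Real.pi * |ξ| * (1 + x ^ 2)) * (C * tail x) :=
        mul_le_mul h1 (h.upper x) (h.nonneg hc x) (by positivity)
    _ = _ := by ring

end Profile

/-! ### The characteristic functions of the two hypotheses -/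

/-- The characteristic function (in the Fourier normalization) of the hypotheses. -/
def spec (β δ ε θ m ξ : ℝ) : ℂ := (baseChar ξ + δ * carrier β ε θ m ξ) / (1 + δ)

/-- The density with characteristic function `spec`. -/
def specDensity (β δ ε θ m x : ℝ) : ℝ :=
  (baseDensity x + δ * (𝓕 (carrier β ε θ m) x).re) / (1 + δ)

/-- Hermitian symmetry makes the Fourier transform real, so perturbed densities are real-valued. -/
lemma fourier_im_eq_zero {w : ℝ → ℂ} (hw : ∀ ξ, w (-ξ) = (starRingEnd ℂ) (w ξ)) (x : ℝ) :
    (𝓕 w x).im = 0 := by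
  rw [← Complex.conj_eq_iff_im, Real.fourier_real_eq_integral_exp_smul, ← integral_conj,
    ← integral_neg_eq_self]
  refine integral_congr_ae (ae_of_all _ fun v => ?_)
  simp only [smul_eq_mul, map_mul, ← Complex.exp_conj, hw, Complex.conj_conj, Complex.conj_ofReal,
    Complex.conj_I]
  congr 2
  push_cast
  ring

lemma carrier_neg (β ε θ m ξ : ℝ) :
    carrier β ε θ m (-ξ) = (starRingEnd ℂ) (carrier β ε θ m ξ) := by
  simp [carrier, japanese_neg, dip_neg, twist_neg]

lemma fourier_spec {β δ ε θ m : ℝ} (hc : Integrable (carrier β ε θ m)) (x : ℝ) :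
    𝓕 (spec β δ ε θ m) x = specDensity β δ ε θ m x := by
  have e : spec β δ ε θ m = fun ξ => (1 + (δ : ℂ))⁻¹ * (baseChar ξ + δ * carrier β ε θ m ξ) := by
    ext ξ; rw [spec, div_eq_inv_mul]
  have hr : 𝓕 (carrier β ε θ m) x = ((𝓕 (carrier β ε θ m) x).re : ℂ) := by
    apply Complex.ext <;> simp [fourier_im_eq_zero (carrier_neg β ε θ m)]
  rw [e, fourier_const_mul_apply, fourier_add_apply integrable_baseChar (hc.const_mul _),
    fourier_const_mul_apply, fourier_baseChar, hr, specDensity]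
  push_cast
  ring

lemma continuous_spec {β δ ε θ m : ℝ} (hc : Continuous (carrier β ε θ m)) :
    Continuous (spec β δ ε θ m) :=
  ((Complex.continuous_ofReal.comp continuous_baseChar).add (continuous_const.mul hc)).div_const _

lemma spec_zero {β δ ε θ m : ℝ} (hδ : 0 < δ) (hm : 4 ≤ m) : spec β δ ε θ m 0 = 1 := by
  have h1 : dip ε m 0 = 1 := dip_eq_one (by linarith) (by
    rw [abs_zero, zero_sub, abs_neg, abs_of_nonneg] <;> linarith)
  have h2 : twist θ m 0 = 1 := twist_eq_one (by simp; linarith)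
  have h3 : (1 + (δ : ℂ)) ≠ 0 := by exact_mod_cast (by positivity : (1 + δ : ℝ) ≠ 0)
  rw [spec, carrier, h1, h2, baseChar_zero, japanese]
  simp [h3]

/-- For a small weight of the carrier, all hypotheses have densities uniformly comparable to
`tail`. -/
lemma exists_profile_spec {β : ℝ} (hβ : 1 < β) : ∃ δ c C : ℝ, 0 < δ ∧ 0 < c ∧ 0 < C ∧
    ∀ m ε θ, 4 ≤ m → 0 ≤ ε → ε ≤ 1 → |θ| ≤ 2 * Real.pi →
      Profile c C (specDensity β δ ε θ m) (spec β δ ε θ m) := by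
  obtain ⟨c, hc, hlow⟩ := exists_tail_le_baseDensity
  obtain ⟨C, hC, hup⟩ := exists_baseDensity_le_tail
  obtain ⟨A, hA, hcar⟩ := exists_symbolBound_carrier β
  have hω := integrable_japanese hβ
  set M := 4 * A * ∫ y, japanese β y with hM
  have hM0 : 0 ≤ M := mul_nonneg (by positivity) (integral_nonneg fun x => (japanese_pos _ _).le)
  -- The carrier's transform, bounded by `M * tail`, may cost at most half of the lower bound `c *
  -- tail`; dividing by `1 + δ ≤ 2` leaves `c / 4`.
  set δ := min 1 (c / (2 * (M + 1))) with hδ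
  have hδ0 : 0 < δ := by positivity
  have hδ1 : δ ≤ 1 := min_le_left _ _
  have hδM : δ * M ≤ c / 2 := by
    calc δ * M ≤ c / (2 * (M + 1)) * (M + 1) := by
          gcongr
          · exact min_le_right _ _
          · linarith
      _ = c / 2 := by field_simp
  refine ⟨δ, c / 4, C + M, hδ0, by positivity, by positivity, fun m ε θ hm h0 h1 hθ => ?_⟩
  have hs := hcar m ε θ h0 h1 hθ
  have hci := hs.integrable hω
  have hcF := hs.norm_fourier_le hω
  have hre : ∀ x, |(𝓕 (carrier β ε θ m) x).re| ≤ M * tail x := fun x =>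
    (abs_re_le_norm _).trans (hcF x)
  have lower : ∀ x, c / 4 * tail x ≤ specDensity β δ ε θ m x := fun x => by
    rw [specDensity, le_div_iff₀ (by positivity)]
    have h1 := neg_le_of_abs_le (hre x)
    have ht := tail_pos x
    have h2 : δ * (M * tail x) ≤ c / 2 * tail x := by nlinarith
    have h3 : -(δ * (M * tail x)) ≤ δ * (𝓕 (carrier β ε θ m) x).re := by nlinarith
    have h4 : c / 4 * tail x * (1 + δ) ≤ c / 2 * tail x := by nlinarith [mul_pos hc ht]
    linarith [hlow x]
  have upper : ∀ x, specDensity β δ ε θ m x ≤ (C + M) * tail x := fun x => by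
    rw [specDensity, div_le_iff₀ (by positivity)]
    have h1 := le_of_abs_le (hre x)
    have ht := tail_pos x
    have h3 : δ * (𝓕 (carrier β ε θ m) x).re ≤ δ * (M * tail x) := by gcongr
    nlinarith [hup x, mul_nonneg hM0 ht.le, mul_pos hC ht, mul_nonneg hδ0.le (mul_nonneg hM0 ht.le),
      mul_nonneg hδ0.le (mul_pos hC ht).le]
  have hF : 𝓕 (spec β δ ε θ m) = fun x => (specDensity β δ ε θ m x : ℂ) :=
    funext fun x => fourier_spec hci x
  have hsi : Integrable (spec β δ ε θ m) :=
    (integrable_baseChar.add (hci.const_mul _)).div_const _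
  have hcont : Continuous (specDensity β δ ε θ m) := by
    have := continuous_fourier hsi
    rw [hF] at this
    exact Complex.continuous_re.comp this
  have hFi : Integrable (𝓕 (spec β δ ε θ m)) := by
    rw [hF]
    refine (integrable_tail.const_mul (C + M)).mono'
      (Complex.continuous_ofReal.comp hcont).aestronglyMeasurable (ae_of_all _ fun x => ?_)
    rw [Complex.norm_real, Real.norm_of_nonneg]
    · exact upper x
    · exact (mul_pos (by positivity) (tail_pos x)).le.trans (lower x)
  refine ⟨hcont, lower, upper, fun ξ => ?_, spec_zero hδ0 hm⟩
  have inv := congrFun ((continuous_spec hs.contDiff.continuous).fourierInv_fourier_eq hsi hFi) ξ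
  rw [← inv, hF, Real.fourierInv_eq']
  refine integral_congr_ae (ae_of_all _ fun x => ?_)
  simp only [smul_eq_mul]
  congr 4
  simp
  ring

lemma baseChar_le_one (ξ : ℝ) : baseChar ξ ≤ 1 := by
  have hB := bspline_zero_pos
  have hcomp : HasCompactSupport fun t => triangle t * triangle t :=
    hasCompactSupport_triangle.mul_right
  have hi : Integrable fun t => triangle t * triangle t :=
    (continuous_triangle.mul continuous_triangle).integrable_of_hasCompactSupport hcomp
  have h0 : bspline 0 = ∫ t, triangle t * triangle t := by
    simp only [bspline, zero_sub, triangle_neg]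
  have hle : bspline ξ ≤ bspline 0 := by
    have hi' : Integrable fun t => triangle (ξ - t) * triangle (ξ - t) := hi.comp_sub_left ξ
    calc bspline ξ ≤ ∫ t, (triangle t * triangle t + triangle (ξ - t) * triangle (ξ - t)) / 2 := by
          refine integral_mono_of_nonneg
            (ae_of_all _ fun t => mul_nonneg (triangle_nonneg _) (triangle_nonneg _))
            ((hi.add hi').div_const 2) (ae_of_all _ fun t => ?_)
          simp only
          nlinarith [sq_nonneg (triangle t - triangle (ξ - t))]
      _ = bspline 0 := by
          rw [integral_div, integral_add hi hi',
            integral_sub_left_eq_self (fun t => triangle t * triangle t) volume ξ, ← h0]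
          ring
  rw [baseChar, div_le_one (by positivity)]
  nlinarith [Real.cos_le_one (Real.pi * ξ), bspline_nonneg ξ]

lemma norm_carrier {β ε θ m : ℝ} (hε0 : 0 ≤ ε) (hε : ε ≤ 1) (hm : 2 ≤ m) (ξ : ℝ) :
    ‖carrier β ε θ m ξ‖ = japanese β ξ * dip ε m ξ := by
  rw [carrier, norm_mul, norm_twist, mul_one, norm_mul, Complex.norm_real, Complex.norm_real,
    Real.norm_of_nonneg (japanese_pos _ _).le, Real.norm_of_nonneg (hε0.trans (le_dip hε hm ξ))]

lemma norm_one_add_ofReal {δ : ℝ} (hδ : 0 < δ) : ‖(1 + δ : ℂ)‖ = 1 + δ := by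
  rw [← Complex.ofReal_one, ← Complex.ofReal_add, Complex.norm_real, Real.norm_of_nonneg]
  positivity

lemma norm_spec_le {β δ ε θ m : ℝ} (hδ : 0 < δ) (hε0 : 0 ≤ ε) (hε : ε ≤ 1) (hm : 2 ≤ m) (ξ : ℝ) :
    ‖spec β δ ε θ m ξ‖ ≤ (baseChar ξ + δ * japanese β ξ) / (1 + δ) := by
  rw [spec, norm_div, norm_one_add_ofReal hδ]
  refine div_le_div_of_nonneg_right ((norm_add_le _ _).trans ?_) (by positivity)
  rw [norm_mul, norm_carrier hε0 hε hm, Complex.norm_real, Complex.norm_real,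
    Real.norm_of_nonneg (baseChar_nonneg _), Real.norm_of_nonneg hδ.le]
  have := mul_le_mul_of_nonneg_left (dip_le_one hε hm ξ) (japanese_pos β ξ).le
  nlinarith

/-- The two summands never cancel: below `m - 1` the twist is trivial and both are nonnegative
reals, while above it `baseChar` vanishes because `m - 1 ≥ 3`. -/
lemma le_norm_spec {β δ ε θ m : ℝ} (hδ : 0 < δ) (hε0 : 0 ≤ ε) (hε : ε ≤ 1) (hm : 4 ≤ m) (ξ : ℝ) :
    δ / (1 + δ) * (japanese β ξ * dip ε m ξ) ≤ ‖spec β δ ε θ m ξ‖ := by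
  have hm2 : 2 ≤ m := by linarith
  rw [spec, norm_div, norm_one_add_ofReal hδ, div_mul_eq_mul_div]
  refine div_le_div_of_nonneg_right ?_ (by positivity)
  by_cases h : |ξ| ≤ m - 1
  · rw [carrier, twist_eq_one h, mul_one, ← Complex.ofReal_mul, ← Complex.ofReal_mul,
      ← Complex.ofReal_add, Complex.norm_real]
    exact le_trans (by linarith [baseChar_nonneg ξ]) (Real.le_norm_self _)
  · rw [baseChar_eq_zero (by linarith), Complex.ofReal_zero, zero_add, norm_mul,
      norm_carrier hε0 hε hm2, Complex.norm_real, Real.norm_of_nonneg hδ.le]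

lemma rpow_le_japanese {β : ℝ} (hβ : 0 ≤ β) (ξ : ℝ) : (1 + |ξ|) ^ (-β) ≤ japanese β ξ := by
  have h : (1 + |ξ|) ^ (-β) = ((1 + |ξ|) ^ 2) ^ (-(β / 2)) := by
    rw [← Real.rpow_natCast, ← Real.rpow_mul (by positivity)]
    congr 1; push_cast; ring
  rw [h, japanese]
  refine Real.rpow_le_rpow_of_nonpos (by positivity) ?_ (by linarith)
  nlinarith [sq_abs ξ, abs_nonneg ξ]

lemma japanese_le_rpow {β ξ : ℝ} (hβ : 0 ≤ β) (hξ : ξ ≠ 0) : japanese β ξ ≤ |ξ| ^ (-β) := by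
  have hx : 0 < |ξ| := abs_pos.2 hξ
  have h : |ξ| ^ (-β) = (ξ ^ 2) ^ (-(β / 2)) := by
    rw [← sq_abs, ← Real.rpow_natCast, ← Real.rpow_mul (by positivity)]
    congr 1; push_cast; ring
  rw [h, japanese]
  exact Real.rpow_le_rpow_of_nonpos (by positivity) (by linarith) (by linarith)

/-- The dip acts only where `|ξ| > m - 2`, and there `2 (1 + |ξ|) ≥ m`. The depth `m ^ (-(b - β))`
thus brings the decay from exponent `β` to `b`, uniformly in `m`. -/
lemma rpow_le_dip {β b m : ℝ} (hβ : 0 ≤ β) (hb : β ≤ b) (hm : 4 ≤ m) (ξ : ℝ) :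
    2 ^ (-b) * (1 + |ξ|) ^ (-(b - β)) ≤ dip (m ^ (-(b - β))) m ξ := by
  have hm2 : 2 ≤ m := by linarith
  have hε : m ^ (-(b - β)) ≤ 1 := Real.rpow_le_one_of_one_le_of_nonpos (by linarith) (by linarith)
  have h2 : (2 : ℝ) ^ (-b) ≤ 1 := Real.rpow_le_one_of_one_le_of_nonpos (by norm_num) (by linarith)
  have h1 : (1 + |ξ|) ^ (-(b - β)) ≤ 1 :=
    Real.rpow_le_one_of_one_le_of_nonpos (by linarith [abs_nonneg ξ]) (by linarith)
  by_cases h : 2 ≤ |(|ξ| - m)|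
  · rw [dip_eq_one hm2 h]
    exact mul_le_one₀ h2 (by positivity) h1
  · refine le_trans ?_ (le_dip hε hm2 ξ)
    rw [not_le, abs_lt] at h
    calc (2 : ℝ) ^ (-b) * (1 + |ξ|) ^ (-(b - β)) ≤ 2 ^ (-(b - β)) * (1 + |ξ|) ^ (-(b - β)) := by
          gcongr
          · norm_num
          · linarith
      _ = (2 * (1 + |ξ|)) ^ (-(b - β)) := (Real.mul_rpow (by norm_num) (by positivity)).symm
      _ ≤ m ^ (-(b - β)) :=
          Real.rpow_le_rpow_of_nonpos (by linarith) (by linarith [h.1]) (by linarith)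

/-- Two regimes. For `2 L |ξ| ≤ 1` one has `1 / (1 + 2 L |ξ|) ≤ 1 - L |ξ|`, and for larger `|ξ|` the
base `1 + c₀ |ξ|` dominates `a ^ (-1/b) (1 + |ξ|)`. The two summands of `c₀` serve one regime each.
-/
lemma exists_lower_envelope {b L a : ℝ} (hb : 1 ≤ b) (hL : 0 < L) (ha : 0 < a) :
    ∃ c₀ : ℝ, 0 < c₀ ∧ ∀ (ξ y : ℝ), 1 - L * |ξ| ≤ y → a * (1 + |ξ|) ^ (-b) ≤ y →
      (1 + c₀ * |ξ|) ^ (-b) ≤ y := by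
  have hab : 0 < a ^ (-(1 / b)) := Real.rpow_pos_of_pos ha _
  refine ⟨2 * L + a ^ (-(1 / b)) * (1 + 2 * L), by positivity, fun ξ y h1 h2 => ?_⟩
  set c₀ := 2 * L + a ^ (-(1 / b)) * (1 + 2 * L)
  have hc₀ : 0 < c₀ := by positivity
  have hξ := abs_nonneg ξ
  by_cases h : 2 * L * |ξ| ≤ 1
  · refine le_trans ?_ h1
    have hbase : 1 ≤ 1 + c₀ * |ξ| := by nlinarith
    calc (1 + c₀ * |ξ|) ^ (-b) ≤ (1 + c₀ * |ξ|) ^ (-1 : ℝ) :=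
          Real.rpow_le_rpow_of_exponent_le hbase (by linarith)
      _ = 1 / (1 + c₀ * |ξ|) := by rw [Real.rpow_neg_one, one_div]
      _ ≤ 1 / (1 + 2 * L * |ξ|) := by
          refine one_div_le_one_div_of_le (by positivity) ?_
          have : 2 * L ≤ c₀ := by
            have : 0 ≤ a ^ (-(1 / b)) * (1 + 2 * L) := by positivity
            linarith
          nlinarith
      _ ≤ 1 - L * |ξ| := by
          rw [div_le_iff₀ (by positivity)]
          nlinarith [mul_nonneg hL.le hξ]
  · refine le_trans ?_ h2
    rw [not_le] at h
    have hge : a ^ (-(1 / b)) * (1 + |ξ|) ≤ 1 + c₀ * |ξ| := by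
      have : 1 + |ξ| ≤ (1 + 2 * L) * |ξ| := by nlinarith
      have h3 := mul_le_mul_of_nonneg_left this hab.le
      have h4 : c₀ * |ξ| = 2 * L * |ξ| + a ^ (-(1 / b)) * ((1 + 2 * L) * |ξ|) := by
        simp only [c₀]; ring
      rw [h4]
      linarith [mul_nonneg (mul_nonneg zero_le_two hL.le) hξ]
    calc (1 + c₀ * |ξ|) ^ (-b) ≤ (a ^ (-(1 / b)) * (1 + |ξ|)) ^ (-b) :=
          Real.rpow_le_rpow_of_nonpos (by positivity) hge (by linarith)
      _ = a * (1 + |ξ|) ^ (-b) := by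
          rw [Real.mul_rpow hab.le (by positivity), ← Real.rpow_mul ha.le]
          congr 1
          rw [show -(1 / b) * -b = 1 by field_simp, Real.rpow_one]

/-- For `|ξ| ≥ 2`, `a ≤ 1/2` gives `1 + a |ξ| ≤ |ξ|`. For `|ξ| < 2`, the second bound on `a` keeps
`(1 + a |ξ|) ^ (-β)` above `l`. -/
lemma exists_upper_envelope {β l : ℝ} (hβ : 1 < β) (hl0 : 0 < l) (hl : l < 1) :
    ∃ a : ℝ, 0 < a ∧ ∀ (ξ y : ℝ), y ≤ l → (2 ≤ |ξ| → y ≤ |ξ| ^ (-β)) →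
      y ≤ (1 + a * |ξ|) ^ (-β) := by
  have hpow : 1 < l ^ (-(1 / β)) :=
    Real.one_lt_rpow_of_pos_of_lt_one_of_neg hl0 hl (by
      have : 0 < 1 / β := by positivity
      linarith)
  refine ⟨min (1 / 2) ((l ^ (-(1 / β)) - 1) / 2), lt_min (by norm_num) (by linarith),
    fun ξ y h1 h2 => ?_⟩
  set a := min (1 / 2) ((l ^ (-(1 / β)) - 1) / 2)
  have ha0 : 0 < a := lt_min (by norm_num) (by linarith)
  have hξ := abs_nonneg ξ
  by_cases h : 2 ≤ |ξ|
  · refine (h2 h).trans (Real.rpow_le_rpow_of_nonpos (by positivity) ?_ (by linarith))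
    have : a ≤ 1 / 2 := min_le_left _ _
    nlinarith
  · refine h1.trans ?_
    have ha : a ≤ (l ^ (-(1 / β)) - 1) / 2 := min_le_right _ _
    have hle : 1 + a * |ξ| ≤ l ^ (-(1 / β)) := by nlinarith
    calc l = (l ^ (-(1 / β))) ^ (-β) := by
          rw [← Real.rpow_mul hl0.le, show -(1 / β) * -β = 1 by field_simp, Real.rpow_one]
      _ ≤ _ := Real.rpow_le_rpow_of_nonpos (by positivity) hle (by linarith)

/-- Rescaled hypotheses belong to the class, for constants which are uniform in the location of
the dip and in the angle of the twist. -/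
lemma exists_inClass {β b δ c C t u₀ CX Cf : ℝ} (hβ : 1 < β) (hb : β ≤ b) (hδ : 0 < δ)
    (hc : 0 < c) (hC : 0 < C) (ht : 0 < t) (hu₀ : 0 < u₀)
    (hP : ∀ m ε θ, 4 ≤ m → 0 ≤ ε → ε ≤ 1 → |θ| ≤ 2 * Real.pi →
      Profile c C (specDensity β δ ε θ m) (spec β δ ε θ m))
    (hCX : t ^ 2 * (C * ∫ x, x ^ 2 * tail x) ≤ CX) (hCf0 : 0 ≤ Cf)
    (hCf : C ^ 2 * (∫ x, tail x ^ 2) / t ≤ Cf ^ 2) :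
    ∃ C₀ C₀' : ℝ, 0 < C₀ ∧ 0 < C₀' ∧ ∀ C₁ C₁' : ℝ, C₀ ≤ C₁ → 0 < C₁' → C₁' ≤ C₀' →
      ∀ m θ, 4 ≤ m → |θ| ≤ 2 * Real.pi →
        InClass β b C₁ C₁' CX Cf u₀ (scaled t (specDensity β δ (m ^ (-(b - β))) θ m)) := by
  set L := 2 * Real.pi * C * ((∫ x, tail x) + ∫ x, x ^ 2 * tail x) + 1 with hL
  have hI1 : 0 ≤ ∫ x, tail x := integral_nonneg fun x => (tail_pos x).le
  have hI2 : 0 ≤ ∫ x, x ^ 2 * tail x :=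
    integral_nonneg fun x => mul_nonneg (sq_nonneg x) (tail_pos x).le
  have hL0 : 0 < L := by positivity
  set s := t / (2 * Real.pi) with hs
  have hs0 : 0 < s := by positivity
  obtain ⟨c₀, hc₀, hlow⟩ := exists_lower_envelope (b := b) (by linarith) hL0
    (by positivity : 0 < δ / (1 + δ) * 2 ^ (-b))
  have hρ : 0 < s * u₀ := by positivity
  have hj : japanese β (s * u₀) < 1 :=
    Real.rpow_lt_one_of_one_lt_of_neg (by nlinarith [sq_pos_of_pos hρ]) (by linarith)
  have hj0 := japanese_pos β (s * u₀)
  -- For `|ξ| ≥ s u₀` the modulus is at most this `l`: `baseChar ≤ 1`, and the weight of the carrier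
  -- is below `1` away from the origin. The bound involves neither `m` nor `θ`.
  obtain ⟨a, ha, hup⟩ := exists_upper_envelope hβ
    (l := (1 + δ * japanese β (s * u₀)) / (1 + δ)) (by positivity)
    (by rw [div_lt_one (by positivity)]; nlinarith)
  refine ⟨c₀ * s, a * s, by positivity, by positivity, fun C₁ C₁' hC₁ hC₁'0 hC₁' m θ hm hθ => ?_⟩
  have hm2 : 2 ≤ m := by linarith
  set ε := m ^ (-(b - β)) with hε
  have hε0 : 0 ≤ ε := Real.rpow_nonneg (by linarith) _
  have hε1 : ε ≤ 1 := Real.rpow_le_one_of_one_le_of_nonpos (by linarith) (by linarith)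
  have h := hP m ε θ hm hε0 hε1 hθ
  refine ⟨h.isDensity hc ht, fun u => ?_, fun u hu => ?_, ?_, h.eLpNorm_le hc ht hCf0 hCf⟩
  · rw [h.charFun_law hc ht]
    have habs : |s * u| = s * |u| := by rw [abs_mul, abs_of_pos hs0]
    calc (1 + C₁ * |u|) ^ (-b) ≤ (1 + c₀ * |s * u|) ^ (-b) := by
          refine Real.rpow_le_rpow_of_nonpos (by positivity) ?_ (by linarith)
          rw [habs, ← mul_assoc]
          gcongr
      _ ≤ _ := by
          refine hlow _ _ ?_ ?_
          · have h1 := h.norm_sub_one_le hc (s * u)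
            have h2 : ‖(1 : ℂ)‖ ≤ ‖spec β δ ε θ m (s * u)‖ + ‖spec β δ ε θ m (s * u) - 1‖ := by
              have := norm_sub_le (spec β δ ε θ m (s * u)) (spec β δ ε θ m (s * u) - 1)
              simpa using this
            rw [norm_one] at h2
            have h3 : L * |s * u| = 2 * Real.pi * C * ((∫ x, tail x) + ∫ x, x ^ 2 * tail x)
              * |s * u| + |s * u| := by rw [hL]; ring
            linarith [abs_nonneg (s * u)]
          · refine le_trans ?_ (le_norm_spec hδ hε0 hε1 hm _)
            rw [mul_assoc]
            refine mul_le_mul_of_nonneg_left ?_ (by positivity)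
            have e : (1 + |s * u|) ^ (-b) =
                (1 + |s * u|) ^ (-β) * (1 + |s * u|) ^ (-(b - β)) := by
              rw [← Real.rpow_add (by positivity)]; congr 1; ring
            rw [e, mul_left_comm]
            exact mul_le_mul (rpow_le_japanese (by linarith) _)
              (rpow_le_dip (by linarith) hb hm _) (by positivity) (japanese_pos _ _).le
  · rw [h.charFun_law hc ht]
    have habs : |s * u| = s * |u| := by rw [abs_mul, abs_of_pos hs0]
    have hsu : s * u₀ ≤ |s * u| := by rw [habs]; gcongr
    have hle := norm_spec_le (β := β) (θ := θ) hδ hε0 hε1 hm2 (s * u)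
    calc _ ≤ (1 + a * |s * u|) ^ (-β) := by
          refine hup _ _ (hle.trans ?_) fun h2 => hle.trans ?_
          · refine div_le_div_of_nonneg_right ?_ (by positivity)
            have : japanese β (s * u) ≤ japanese β (s * u₀) := by
              refine Real.rpow_le_rpow_of_nonpos (by positivity) ?_ (by linarith)
              have := pow_le_pow_left₀ hρ.le hsu 2
              rw [sq_abs] at this
              linarith
            nlinarith [baseChar_le_one (s * u)]
          · have hne : s * u ≠ 0 := by
              intro h0; rw [h0, abs_zero] at h2; linarith
            rw [baseChar_eq_zero h2, zero_add, mul_div_right_comm]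
            refine le_trans ?_ (japanese_le_rpow (by linarith) hne)
            have : δ / (1 + δ) ≤ 1 := by rw [div_le_one (by positivity)]; linarith
            nlinarith [japanese_pos β (s * u)]
      _ ≤ (1 + C₁' * |u|) ^ (-β) := by
          refine Real.rpow_le_rpow_of_nonpos (by positivity) ?_ (by linarith)
          rw [habs, ← mul_assoc]
          gcongr
  · exact (h.lintegral_sq_le hc ht).trans (ENNReal.ofReal_le_ofReal hCX)

/-! ### Closeness of the aggregated laws -/

lemma spec_neg (β δ ε θ m ξ : ℝ) : spec β δ ε θ m (-ξ) = (starRingEnd ℂ) (spec β δ ε θ m ξ) := by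
  simp [spec, carrier_neg, baseChar_neg]

/-- The indicator of `[m - 2, m + 2] ∪ [-m - 2, -m + 2]` (counted with multiplicity). -/
def window (m ξ : ℝ) : ℝ :=
  (Set.Icc (m - 2) (m + 2)).indicator 1 ξ + (Set.Icc (-m - 2) (-m + 2)).indicator 1 ξ

lemma window_nonneg (m ξ : ℝ) : 0 ≤ window m ξ :=
  add_nonneg (Set.indicator_nonneg (fun _ _ => zero_le_one) _)
    (Set.indicator_nonneg (fun _ _ => zero_le_one) _)

lemma integrable_indicator_Icc_one (a b : ℝ) :
    Integrable ((Set.Icc a b).indicator (1 : ℝ → ℝ)) :=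
  (integrable_indicator_iff measurableSet_Icc).2 (by
    rw [Pi.one_def]; exact integrableOn_const (by simp))

lemma integrable_window (m : ℝ) : Integrable (window m) :=
  (integrable_indicator_Icc_one _ _).add (integrable_indicator_Icc_one _ _)

lemma integral_window (m : ℝ) : ∫ ξ, window m ξ = 8 := by
  unfold window
  rw [integral_add (integrable_indicator_Icc_one _ _) (integrable_indicator_Icc_one _ _),
    integral_indicator_one measurableSet_Icc, integral_indicator_one measurableSet_Icc,
    Real.volume_real_Icc_of_le (by linarith), Real.volume_real_Icc_of_le (by linarith)]
  ring

lemma window_cases (m ξ : ℝ) : (1 ≤ window m ξ ∧ m - 2 ≤ |ξ|) ∨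
    (window m ξ = 0 ∧ ξ ∉ Set.Icc (m - 2) (m + 2) ∧ ξ ∉ Set.Icc (-m - 2) (-m + 2)) := by
  have h0 : ∀ S : Set ℝ, 0 ≤ S.indicator (1 : ℝ → ℝ) ξ := fun S =>
    Set.indicator_nonneg (fun _ _ => zero_le_one) _
  by_cases h1 : ξ ∈ Set.Icc (m - 2) (m + 2)
  · refine Or.inl ⟨?_, h1.1.trans (le_abs_self ξ)⟩
    rw [window, Set.indicator_of_mem h1]
    simpa using h0 _
  · by_cases h2 : ξ ∈ Set.Icc (-m - 2) (-m + 2)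
    · refine Or.inl ⟨?_, ?_⟩
      · rw [window, Set.indicator_of_mem h2]
        simpa using h0 _
      · have := neg_le_abs ξ
        linarith [h2.2]
    · exact Or.inr ⟨by simp [window, Set.indicator_of_notMem h1, Set.indicator_of_notMem h2],
        h1, h2⟩

/-- Off the window the function vanishes in a neighbourhood, hence with all its derivatives. The
integrable weight `window`, of integral `8` for every `m`, can therefore replace the constant one.
-/
lemma exists_symbolBound_bumpPair_window : ∃ A, 0 ≤ A ∧ ∀ m,
    SymbolBound (window m) A (fun ξ => (bumpPair m ξ : ℂ)) := by
  obtain ⟨A, hA, h⟩ := exists_symbolBound_bumpPair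
  refine ⟨A, hA, fun m => ⟨(h m).contDiff, fun k hk x => ?_⟩⟩
  rcases window_cases m x with ⟨hw, -⟩ | ⟨hw, h1, h2⟩
  · calc _ ≤ A * 1 := (h m).bound k hk x
      _ ≤ A * window m x := by gcongr
  · have he : (fun ξ => (bumpPair m ξ : ℂ)) =ᶠ[nhds x] fun _ => 0 := by
      filter_upwards [isClosed_Icc.isOpen_compl.mem_nhds h1,
        isClosed_Icc.isOpen_compl.mem_nhds h2] with y hy1 hy2
      have b1 : bump (y - m) = 0 := by
        refine bump_eq_zero (le_of_not_gt fun hlt => hy1 ?_)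
        rw [abs_lt] at hlt
        constructor <;> linarith [hlt.1, hlt.2]
      have b2 : bump (y + m) = 0 := by
        refine bump_eq_zero (le_of_not_gt fun hlt => hy2 ?_)
        rw [abs_lt] at hlt
        constructor <;> linarith [hlt.1, hlt.2]
      simp [bumpPair, b1, b2]
    rw [he.iteratedDeriv_eq, iteratedDeriv_const, hw]
    simp

lemma japanese_le_of_half_le {β m ξ : ℝ} (hβ : 0 ≤ β) (hm : 0 < m) (h : m / 2 ≤ |ξ|) :
    japanese β ξ ≤ 2 ^ β * m ^ (-β) := by
  have hx : 0 < |ξ| := by linarith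
  refine (japanese_le_rpow hβ (abs_pos.1 hx)).trans ?_
  calc |ξ| ^ (-β) ≤ (m / 2) ^ (-β) :=
        Real.rpow_le_rpow_of_nonpos (by positivity) h (by linarith)
    _ = 2 ^ β * m ^ (-β) := by
        rw [Real.div_rpow hm.le (by norm_num), Real.rpow_neg (by norm_num : (0 : ℝ) ≤ 2)]
        field_simp

/-- The heart of the construction. For `|ξ| ≤ m - 1` neither hypothesis is twisted. For `|ξ| ≥ m`
the `K`-th power turns the phase by `±2π`, which is invisible. In between, `dip = ε`, `bumpPair = 1`
and `baseChar = 0`. The factor `bumpPair` records the localization without changing the value. -/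
lemma spec_pow_sub_spec_pow {β δ ε m : ℝ} (hm : 4 ≤ m) {K : ℕ} (hK : K ≠ 0) (ξ : ℝ) :
    spec β δ ε 0 m ξ ^ K - spec β δ ε (2 * Real.pi / K) m ξ ^ K =
      ((δ * ε / (1 + δ) : ℝ) : ℂ) ^ K * ((japanese β ξ : ℂ) ^ K *
        (bumpPair m ξ * (1 - twist (2 * Real.pi) m ξ))) := by
  have hK' : (K : ℝ) ≠ 0 := by exact_mod_cast hK
  have hm2 : 2 ≤ m := by linarith
  by_cases h : |ξ| ≤ m - 1
  · simp [spec, carrier, twist_eq_one h]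
  · have hb : baseChar ξ = 0 := baseChar_eq_zero (by linarith)
    have e : spec β δ ε 0 m ξ ^ K - spec β δ ε (2 * Real.pi / K) m ξ ^ K =
        ((δ * (japanese β ξ * dip ε m ξ) / (1 + δ) : ℝ) : ℂ) ^ K *
          (1 - twist (2 * Real.pi) m ξ) := by
      have h1 : twist (2 * Real.pi / K) m ξ ^ K = twist (2 * Real.pi) m ξ := by
        rw [twist_pow]; congr 1; field_simp
      rw [spec, spec, carrier, carrier, hb, twist_zero, ← h1]
      push_cast
      ring
    rw [e]
    by_cases h2 : |ξ| ≤ m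
    · have hd : |(|ξ| - m)| ≤ 1 := by rw [abs_le]; constructor <;> linarith
      rw [dip_eq hm2 hd, bumpPair_eq hm2, bump_eq_one hd]
      push_cast
      ring
    · have ht : twist (2 * Real.pi) m ξ = 1 := by
        rw [not_le] at h2
        rcases lt_abs.1 h2 with h3 | h3
        · rw [twist, phase_eq_one (by linarith) h3.le, mul_one]
          push_cast
          exact Complex.exp_two_pi_mul_I
        · rw [twist, phase_eq_neg_one (by linarith) (by linarith), mul_neg_one]
          push_cast
          rw [neg_mul, Complex.exp_neg, Complex.exp_two_pi_mul_I, inv_one]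
      rw [ht]; simp

/-- The difference of the characteristic functions of the sums, as a symbol: it is of size
`(ε m^(-β))^K`. -/
lemma exists_symbolBound_spec_pow_sub {β δ : ℝ} (hβ : 0 ≤ β) (hδ : 0 < δ) {K : ℕ} (hK : K ≠ 0) :
    ∃ A, 0 ≤ A ∧ ∀ m ε, 4 ≤ m → 0 ≤ ε → ε ≤ 1 →
      SymbolBound (window m) (A * (ε * m ^ (-β)) ^ K)
        (fun ξ => spec β δ ε 0 m ξ ^ K - spec β δ ε (2 * Real.pi / K) m ξ ^ K) := by
  obtain ⟨A₁, h₁, H₁⟩ := exists_symbolBound_japanese β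
  obtain ⟨A₂, h₂, H₂⟩ := exists_symbolBound_bumpPair_window
  obtain ⟨A₃, h₃, H₃⟩ := exists_symbolBound_twist (2 * Real.pi) (by positivity)
  set G := 16 * (16 * A₁) ^ K * (16 * A₂ * (1 + A₃)) with hG
  have hG0 : 0 ≤ G := by positivity
  refine ⟨G * (2 ^ β) ^ K, by positivity, fun m ε hm h0 h1 => ?_⟩
  have hθ : |2 * Real.pi| ≤ 2 * Real.pi := (abs_of_pos (by positivity)).le
  have hsub := (SymbolBound.const 1).sub (H₃ m (2 * Real.pi) hθ)
  rw [norm_one] at hsub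
  have := ((H₁.pow K).mul ((H₂ m).mul hsub)).const_mul (((δ * ε / (1 + δ) : ℝ) : ℂ) ^ K)
  rw [show (fun ξ => spec β δ ε 0 m ξ ^ K - spec β δ ε (2 * Real.pi / K) m ξ ^ K) = _ from
    funext (spec_pow_sub_spec_pow hm hK)]
  refine this.mono fun ξ => ?_
  rw [norm_pow, Complex.norm_real, Real.norm_of_nonneg (by positivity), ← hG]
  rcases window_cases m ξ with ⟨hw, hx⟩ | ⟨hw, -⟩
  -- On the window `|ξ| ≥ m - 2 ≥ m / 2`, as `m ≥ 4`.
  · have hj := japanese_le_of_half_le (ξ := ξ) hβ (by linarith : 0 < m) (by linarith)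
    have hjK := pow_le_pow_left₀ (japanese_pos β ξ).le hj K
    have hδ1 : δ * ε / (1 + δ) ≤ ε := by
      rw [div_le_iff₀ (by positivity)]; nlinarith
    have hδK := pow_le_pow_left₀ (by positivity) hδ1 K
    have hm0 : 0 ≤ m := by linarith
    have hw0 := window_nonneg m ξ
    have hmp : 0 ≤ m ^ (-β) := Real.rpow_nonneg hm0 _
    calc (δ * ε / (1 + δ)) ^ K * G * (japanese β ξ ^ K * (window m ξ * 1))
        ≤ ε ^ K * G * ((2 ^ β * m ^ (-β)) ^ K * (window m ξ * 1)) := by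
          have := (japanese_pos β ξ).le
          have : 0 ≤ japanese β ξ ^ K * (window m ξ * 1) := by positivity
          gcongr
      _ = _ := by rw [mul_pow, mul_pow]; ring
  · rw [hw]; simp

lemma tail_div_le {t : ℝ} (ht : 0 < t) (x : ℝ) : tail (x / t) ≤ (1 + t ^ 2) ^ 2 * tail x := by
  unfold tail
  rw [← div_eq_mul_inv, inv_eq_one_div, div_le_div_iff₀ (by positivity) (by positivity), one_mul,
    ← mul_pow]
  refine pow_le_pow_left₀ (by positivity) ?_ 2
  have : (1 + t ^ 2) * (1 + (x / t) ^ 2) = 1 + x ^ 2 + t ^ 2 + (x / t) ^ 2 := by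
    field_simp; ring
  rw [this]
  nlinarith [sq_nonneg t, sq_nonneg (x / t)]

lemma tail_le_tail_div {t : ℝ} (ht : 0 < t) (x : ℝ) :
    tail x / (1 + t⁻¹ ^ 2) ^ 2 ≤ tail (x / t) := by
  rw [div_le_iff₀ (by positivity), mul_comm]
  have := tail_div_le (inv_pos.2 ht) (x / t)
  rwa [div_inv_eq_mul, div_mul_cancel₀ _ ht.ne'] at this

/-- The laws of the sums are within a factor `1 ± A (ε m^(-β))^K` of each other. -/
lemma exists_aggregatedLaw_close {β δ c C t : ℝ} (hβ : 1 < β) (hδ : 0 < δ) (hc : 0 < c)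
    (ht : 0 < t)
    (hP : ∀ m ε θ, 4 ≤ m → 0 ≤ ε → ε ≤ 1 → |θ| ≤ 2 * Real.pi →
      Profile c C (specDensity β δ ε θ m) (spec β δ ε θ m)) {K : ℕ} (hK : K ≠ 0) :
    ∃ A, 0 ≤ A ∧ ∀ m ε, 4 ≤ m → 0 ≤ ε → ε ≤ 1 →
      aggregatedLaw K (scaled t (specDensity β δ ε (2 * Real.pi / K) m)) ≤
          aggregatedLaw K (scaled t (specDensity β δ ε 0 m)) +
          ENNReal.ofReal (A * (ε * m ^ (-β)) ^ K) •
            aggregatedLaw K (scaled t (specDensity β δ ε 0 m)) ∧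
        aggregatedLaw K (scaled t (specDensity β δ ε 0 m)) ≤
          aggregatedLaw K (scaled t (specDensity β δ ε (2 * Real.pi / K) m)) +
          ENNReal.ofReal (A * (ε * m ^ (-β)) ^ K) •
            aggregatedLaw K (scaled t (specDensity β δ ε 0 m)) := by
  obtain ⟨A, hA, hsym⟩ := exists_symbolBound_spec_pow_sub (by linarith : 0 ≤ β) hδ hK
  set c' := c / (1 + t⁻¹ ^ 2) ^ 2 / t with hc'
  have hc'0 : 0 < c' := by positivity
  obtain ⟨e, he, hagg⟩ := exists_tailMeasure_le_aggregatedLaw hc'0 K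
  set T := (1 + t ^ 2) ^ 2 / t with hT
  -- The factor `32` is `4` from `SymbolBound.norm_fourier_le` times the integral `8` of the window.
  -- `T` pays for rescaling the tail, and `1 / e` for passing from `tailMeasure` to the law of the
  -- sum.
  refine ⟨T * (32 * A) / e, by positivity, fun m ε hm h0 h1 => ?_⟩
  have hK1 : (1 : ℝ) ≤ K := by exact_mod_cast Nat.one_le_iff_ne_zero.2 hK
  have hθ : |2 * Real.pi / K| ≤ 2 * Real.pi := by
    rw [abs_of_pos (by positivity)]
    exact div_le_self (by positivity) hK1
  have P0 := hP m ε 0 hm h0 h1 (by rw [abs_zero]; positivity)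
  have P1 := hP m ε _ hm h0 h1 hθ
  have d0 := P0.isDensity hc ht
  have d1 := P1.isDensity hc ht
  have := isProbabilityMeasure_aggregatedLaw K d0
  have := isProbabilityMeasure_aggregatedLaw K d1
  set f₀ := scaled t (specDensity β δ ε 0 m)
  set f₁ := scaled t (specDensity β δ ε (2 * Real.pi / K) m)
  set D : ℝ → ℂ := fun ξ => spec β δ ε 0 m ξ ^ K - spec β δ ε (2 * Real.pi / K) m ξ ^ K with hD
  set a := A * (ε * m ^ (-β)) ^ K with ha
  have hm0 : 0 ≤ m := by linarith
  have ha0 : 0 ≤ a :=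
    mul_nonneg hA (pow_nonneg (mul_nonneg h0 (Real.rpow_nonneg hm0 _)) _)
  have hs : SymbolBound (window m) a D := hsym m ε hm h0 h1
  have hwi := integrable_window m
  have hFb : ∀ x, ‖𝓕 D x‖ ≤ 32 * a * tail x := fun x => by
    refine (hs.norm_fourier_le hwi x).trans_eq ?_
    rw [integral_window]; ring
  have hreal : ∀ x, 𝓕 D x = ((𝓕 D x).re : ℂ) := fun x => by
    have := fourier_im_eq_zero (w := D) (fun ξ => by simp [hD, spec_neg]) x
    apply Complex.ext <;> simp [this]
  have hFc := continuous_fourier (hs.integrable hwi)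
  set g : ℝ → ℝ := fun x => (𝓕 D x).re with hg
  have hgc : Continuous g := Complex.continuous_re.comp hFc
  have hgb : ∀ x, |g x| ≤ 32 * a * tail x := fun x => (abs_re_le_norm _).trans (hFb x)
  have hsb : ∀ x, |scaled t g x| ≤ T * (32 * a) * tail x := fun x => by
    rw [scaled, abs_div, abs_of_pos ht, hT, div_mul_eq_mul_div, div_mul_eq_mul_div]
    refine div_le_div_of_nonneg_right ((hgb _).trans ?_) ht.le
    calc 32 * a * tail (x / t) ≤ 32 * a * ((1 + t ^ 2) ^ 2 * tail x) := by
          gcongr; exact tail_div_le ht x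
      _ = _ := by ring
  have hinv : ∀ ξ : ℝ, ∫ x : ℝ, Complex.exp (((2 * Real.pi * x * ξ : ℝ) : ℂ) * I) * g x = D ξ := by
    intro ξ
    rw [← hs.contDiff.continuous.fourierInv_fourier_eq (hs.integrable hwi)
      (hs.integrable_fourier hwi), Real.fourierInv_eq']
    refine integral_congr_ae (ae_of_all _ fun x => ?_)
    simp only [smul_eq_mul]
    rw [hreal x]
    congr 4
    simp
    ring
  have hchar : ∀ u : ℝ, ∫ x : ℝ, Complex.exp (u * x * I) * scaled t g x =
      charFun (aggregatedLaw K f₀) u - charFun (aggregatedLaw K f₁) u := by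
    intro u
    rw [charFun_aggregatedLaw K d0, charFun_aggregatedLaw K d1, P0.charFun_law hc ht,
      P1.charFun_law hc ht]
    change _ = D _
    rw [← hinv]
    have := Profile.integral_scaled_mul ht g fun x : ℝ => Complex.exp (u * x * I)
    simp only [Complex.real_smul] at this
    simp_rw [mul_comm (Complex.exp _)]
    rw [this]
    refine integral_congr_ae (ae_of_all _ fun y => ?_)
    simp only
    congr 3
    have : (Real.pi : ℂ) ≠ 0 := by exact_mod_cast Real.pi_ne_zero
    push_cast
    field_simp
  have hsc : Continuous (scaled t g) := (hgc.comp (continuous_id.div_const t)).div_const t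
  have hT0 : 0 ≤ T * (32 * a) := by positivity
  have hlow : ∀ x, c' * tail x ≤ f₀ x := fun x => by
    rw [hc', div_mul_eq_mul_div]
    refine div_le_div_of_nonneg_right (le_trans ?_ (P0.lower _)) ht.le
    rw [div_mul_eq_mul_div, mul_div_assoc]
    exact mul_le_mul_of_nonneg_left (tail_le_tail_div ht x) hc.le
  have hcmp : ENNReal.ofReal (T * (32 * a)) • tailMeasure ≤
      ENNReal.ofReal (T * (32 * A) / e * (ε * m ^ (-β)) ^ K) • aggregatedLaw K f₀ := by
    have e1 : T * (32 * a) = T * (32 * A) / e * (ε * m ^ (-β)) ^ K * e := by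
      rw [ha]; field_simp
    rw [e1, ENNReal.ofReal_mul (by
      exact mul_nonneg (by positivity)
        (pow_nonneg (mul_nonneg h0 (Real.rpow_nonneg hm0 _)) _)), mul_smul]
    refine Measure.le_iff.2 fun S _ => ?_
    have := (hagg f₀ d0 hlow).2 hK S
    simp only [Measure.smul_apply, smul_eq_mul] at this ⊢
    gcongr
  constructor
  · refine (le_add_tailMeasure hsc.neg (η := T * (32 * a)) (fun x => ?_) hT0 fun u => ?_).trans
      (add_le_add le_rfl hcmp)
    · rw [Pi.neg_apply, abs_neg]; exact hsb x
    · simp only [Pi.neg_apply, Complex.ofReal_neg, mul_neg]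
      rw [integral_neg, hchar, neg_sub]
  · exact (le_add_tailMeasure hsc hsb hT0 fun u => (hchar u).symm).trans (add_le_add le_rfl hcmp)

/-! ### Separation of the two hypotheses -/

/-- Plancherel for the difference of the two characteristic functions. -/
lemma integral_sq_specDensity_sub {β δ ε θ m c C : ℝ} (hβ : 1 < β) (hc : 0 < c)
    (h0 : 0 ≤ ε) (h1 : ε ≤ 1) (hθ : |θ| ≤ 2 * Real.pi)
    (P0 : Profile c C (specDensity β δ ε 0 m) (spec β δ ε 0 m))
    (P1 : Profile c C (specDensity β δ ε θ m) (spec β δ ε θ m)) :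
    ∫ x, (specDensity β δ ε 0 m x - specDensity β δ ε θ m x) ^ 2 =
      ∫ ξ, ‖spec β δ ε 0 m ξ - spec β δ ε θ m ξ‖ ^ 2 := by
  obtain ⟨A, -, hcar⟩ := exists_symbolBound_carrier β
  have hω := integrable_japanese hβ
  have hs0 := hcar m ε 0 h0 h1 (by rw [abs_zero]; positivity)
  have hs1 := hcar m ε θ h0 h1 hθ
  have hi : ∀ {θ}, Integrable (carrier β ε θ m) → Integrable (spec β δ ε θ m) := fun h =>
    (integrable_baseChar.add (h.const_mul _)).div_const _
  have i0 := hi (hs0.integrable hω)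
  have i1 := hi (hs1.integrable hω)
  have hF : 𝓕 (fun ξ => spec β δ ε 0 m ξ - spec β δ ε θ m ξ) =
      fun x => ((specDensity β δ ε 0 m x - specDensity β δ ε θ m x : ℝ) : ℂ) := by
    ext x
    have e : (fun ξ => spec β δ ε 0 m ξ - spec β δ ε θ m ξ) =
        fun ξ => spec β δ ε 0 m ξ + (-1) * spec β δ ε θ m ξ := by ext; ring
    rw [e, fourier_add_apply i0 (i1.const_mul _), fourier_const_mul_apply,
      fourier_spec (hs0.integrable hω), fourier_spec (hs1.integrable hω)]
    push_cast
    ring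
  have hFi : Integrable (𝓕 (fun ξ => spec β δ ε 0 m ξ - spec β δ ε θ m ξ)) := by
    rw [hF]
    exact ((P0.integrable hc).sub (P1.integrable hc)).ofReal
  have := integral_norm_sq_fourier ((continuous_spec hs0.contDiff.continuous).sub
    (continuous_spec hs1.contDiff.continuous)) (i0.sub i1) hFi
  refine Eq.trans ?_ this
  refine integral_congr_ae (ae_of_all _ fun x => ?_)
  change _ = ‖𝓕 (fun ξ => spec β δ ε 0 m ξ - spec β δ ε θ m ξ) x‖ ^ 2
  rw [congrFun hF x, Complex.norm_real, Real.norm_eq_abs, sq_abs]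

lemma spec_sub_spec_of_large {β δ ε θ m ξ : ℝ} (hm : 4 ≤ m) (hξ : m + 2 ≤ ξ) :
    spec β δ ε 0 m ξ - spec β δ ε θ m ξ =
      ((δ / (1 + δ) * japanese β ξ : ℝ) : ℂ) * (1 - Complex.exp (θ * I)) := by
  have habs : |ξ| = ξ := abs_of_nonneg (by linarith)
  have hb : baseChar ξ = 0 := baseChar_eq_zero (by rw [habs]; linarith)
  have hd : dip ε m ξ = 1 := dip_eq_one (by linarith) (by
    rw [habs, abs_of_nonneg] <;> linarith)
  rw [spec, spec, carrier, carrier, hb, hd, twist_zero, twist,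
    phase_eq_one (by linarith) (by linarith), mul_one θ]
  push_cast
  ring

lemma exists_separation {β δ c C t θ : ℝ} (hβ : 1 < β) (hδ : 0 < δ) (hc : 0 < c) (ht : 0 < t)
    (hθ0 : 0 < θ) (hθ : θ ≤ Real.pi)
    (hP : ∀ m ε θ, 4 ≤ m → 0 ≤ ε → ε ≤ 1 → |θ| ≤ 2 * Real.pi →
      Profile c C (specDensity β δ ε θ m) (spec β δ ε θ m)) :
    ∃ q : ℝ, 0 < q ∧ ∀ m ε, 4 ≤ m → 0 ≤ ε → ε ≤ 1 →
      ENNReal.ofReal (q * m ^ (1 - 2 * β)) ≤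
        ∫⁻ x, ENNReal.ofReal ((scaled t (specDensity β δ ε 0 m) x -
          scaled t (specDensity β δ ε θ m) x) ^ 2) := by
  have hθ' : |θ| ≤ 2 * Real.pi := by
    rw [abs_of_pos hθ0]; linarith [Real.pi_pos]
  set z : ℂ := 1 - Complex.exp (θ * I) with hz
  have hz0 : 0 < ‖z‖ := by
    refine norm_pos_iff.2 fun h => ?_
    have hre := congrArg Complex.re h
    rw [hz, Complex.sub_re, Complex.exp_ofReal_mul_I_re, Complex.one_re, Complex.zero_re] at hre
    have : Real.cos θ < Real.cos 0 :=
      Real.cos_lt_cos_of_nonneg_of_le_pi le_rfl hθ hθ0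
    rw [Real.cos_zero] at this
    linarith
  -- For `m + 2 ≤ ξ ≤ 2m` one has `1 + ξ² ≤ 5 m²`, so there the difference of the characteristic
  -- functions is at least `a * m ^ (-β)`.
  set a := δ / (1 + δ) * 5 ^ (-(β / 2)) * ‖z‖ with ha
  have ha0 : 0 < a := by positivity
  refine ⟨a ^ 2 / 2 / t, by positivity, fun m ε hm h0 h1 => ?_⟩
  have hm0 : 0 < m := by linarith
  have P0 := hP m ε 0 hm h0 h1 (by rw [abs_zero]; positivity)
  have P1 := hP m ε θ hm h0 h1 hθ'
  set G : ℝ → ℝ := fun x => specDensity β δ ε 0 m x - specDensity β δ ε θ m x with hG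
  have hGs : ∀ x, scaled t (specDensity β δ ε 0 m) x - scaled t (specDensity β δ ε θ m) x =
      scaled t G x := fun x => by simp only [scaled, hG]; ring
  have hGc : Continuous G := P0.continuous.sub P1.continuous
  have hGt : ∀ x, |G x| ≤ C * tail x := fun x => by
    rw [abs_le]
    constructor <;> simp only [hG] <;>
      linarith [P0.upper x, P1.upper x, P0.nonneg hc x, P1.nonneg hc x]
  have hG2 : Integrable fun x => G x ^ 2 :=
    (integrable_tail_sq.const_mul (C ^ 2)).mono' (hGc.pow 2).aestronglyMeasurable
      (ae_of_all _ fun x => by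
        rw [Real.norm_of_nonneg (sq_nonneg _), ← sq_abs, ← mul_pow]
        exact pow_le_pow_left₀ (abs_nonneg _) (hGt x) 2)
  have hGS : Integrable fun x => scaled t G x ^ 2 := by
    refine ((hG2.comp_div ht.ne').div_const (t ^ 2)).congr (ae_of_all _ fun x => ?_)
    simp only [scaled, div_pow]
  simp_rw [hGs]
  rw [← ofReal_integral_eq_lintegral_ofReal hGS (ae_of_all _ fun x => sq_nonneg _)]
  refine ENNReal.ofReal_le_ofReal ?_
  have e1 : ∫ x, scaled t G x ^ 2 = (∫ x, G x ^ 2) / t := by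
    have := Profile.integral_scaled_mul ht G (scaled t G)
    simp only [smul_eq_mul, ← sq] at this
    rw [this, ← integral_div]
    refine integral_congr_ae (ae_of_all _ fun x => ?_)
    simp only [scaled]
    rw [mul_div_cancel_left₀ _ ht.ne', ← mul_div_assoc, ← sq]
  rw [e1, div_mul_eq_mul_div]
  refine div_le_div_of_nonneg_right ?_ ht.le
  have pl := integral_sq_specDensity_sub hβ hc h0 h1 hθ' P0 P1
  change ∫ x, G x ^ 2 = _ at pl
  have hpos : 0 ≤ a ^ 2 * m ^ (-(2 * β)) := by positivity
  have hWi : Integrable fun ξ => ‖spec β δ ε 0 m ξ - spec β δ ε θ m ξ‖ ^ 2 := by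
    obtain ⟨A, -, hcar⟩ := exists_symbolBound_carrier β
    have hω := integrable_japanese hβ
    have hs0 := hcar m ε 0 h0 h1 (by rw [abs_zero]; positivity)
    have hs1 := hcar m ε θ h0 h1 hθ'
    have hi : ∀ {θ}, Integrable (carrier β ε θ m) → Integrable (spec β δ ε θ m) := fun h =>
      (integrable_baseChar.add (h.const_mul _)).div_const _
    have hb : ∀ θ ξ, ‖spec β δ ε θ m ξ‖ ≤ 1 := fun θ ξ => by
      refine (norm_spec_le hδ h0 h1 (by linarith) ξ).trans ?_
      rw [div_le_one (by positivity)]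
      have : japanese β ξ ≤ 1 := Real.rpow_le_one_of_one_le_of_nonpos
        (by nlinarith [sq_nonneg ξ]) (by linarith)
      nlinarith [baseChar_le_one ξ]
    have c0 := continuous_spec (δ := δ) hs0.contDiff.continuous
    have c1 := continuous_spec (δ := δ) hs1.contDiff.continuous
    refine (((hi (hs0.integrable hω)).sub (hi (hs1.integrable hω))).norm.const_mul 2).mono'
      ((c0.sub c1).norm.pow 2).aestronglyMeasurable (ae_of_all _ fun ξ => ?_)
    rw [Real.norm_of_nonneg (sq_nonneg _), sq]
    refine mul_le_mul_of_nonneg_right ?_ (norm_nonneg _)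
    refine (norm_sub_le _ _).trans ?_
    linarith [hb 0 ξ, hb θ ξ]
  rw [pl]
  calc a ^ 2 / 2 * m ^ (1 - 2 * β) = a ^ 2 * m ^ (-(2 * β)) * (m / 2) := by
        rw [show 1 - 2 * β = -(2 * β) + 1 by ring, Real.rpow_add hm0, Real.rpow_one]; ring
    -- The interval `[m + 2, 2m]`, beyond the dip, has length `m - 2 ≥ m / 2`.
    _ ≤ a ^ 2 * m ^ (-(2 * β)) * (2 * m - (m + 2)) := by gcongr; linarith
    _ = ∫ _ξ in Set.Icc (m + 2) (2 * m), a ^ 2 * m ^ (-(2 * β)) := by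
        rw [setIntegral_const, Real.volume_real_Icc_of_le (by linarith), smul_eq_mul, mul_comm]
    _ ≤ ∫ ξ in Set.Icc (m + 2) (2 * m), ‖spec β δ ε 0 m ξ - spec β δ ε θ m ξ‖ ^ 2 := by
        refine setIntegral_mono_on (integrableOn_const (by simp)) hWi.integrableOn
          measurableSet_Icc fun ξ hξ => ?_
        rw [spec_sub_spec_of_large hm hξ.1, norm_mul, Complex.norm_real,
          Real.norm_of_nonneg (mul_nonneg (by positivity) (japanese_pos _ _).le), ← hz]
        have hj : 5 ^ (-(β / 2)) * m ^ (-β) ≤ japanese β ξ := by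
          have e : m ^ (-β) = (m ^ 2) ^ (-(β / 2)) := by
            rw [← Real.rpow_natCast, ← Real.rpow_mul hm0.le]
            congr 1; push_cast; ring
          rw [e, ← Real.mul_rpow (by norm_num) (by positivity), japanese]
          refine Real.rpow_le_rpow_of_nonpos (by positivity) ?_ (by linarith)
          nlinarith [hξ.1, hξ.2]
        have e2 : a ^ 2 * m ^ (-(2 * β)) =
            (δ / (1 + δ) * (5 ^ (-(β / 2)) * m ^ (-β)) * ‖z‖) ^ 2 := by
          have : m ^ (-(2 * β)) = (m ^ (-β)) ^ 2 := by
            rw [← Real.rpow_natCast, ← Real.rpow_mul hm0.le]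
            congr 1; push_cast; ring
          rw [this, ha]; ring
        rw [e2]
        refine pow_le_pow_left₀ (by positivity) ?_ 2
        gcongr
    _ ≤ _ := setIntegral_le_integral hWi (ae_of_all _ fun ξ => sq_nonneg _)

/-! ### The minimax lower bound -/

lemma Estimator.measurable_loss {n : ℕ} (g : Estimator n) {f : ℝ → ℝ} (hf : Measurable f) :
    Measurable fun y => ∫⁻ x, ENNReal.ofReal ((f x - g.est y x) ^ 2) := by
  refine Measurable.lintegral_prod_right (f := fun y x => ENNReal.ofReal ((f x - g.est y x) ^ 2)) ?_
  exact (((hf.comp measurable_snd).sub g.measurable_est).pow_const 2).ennreal_ofReal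

lemma Estimator.loss_add_loss {n : ℕ} (g : Estimator n) {f₀ f₁ : ℝ → ℝ} (h₀ : Measurable f₀)
    {D : ℝ}
    (hsep : ENNReal.ofReal D ≤ ∫⁻ x, ENNReal.ofReal ((f₀ x - f₁ x) ^ 2)) (y : Fin n → ℝ) :
    ENNReal.ofReal (D / 2) ≤ (∫⁻ x, ENNReal.ofReal ((f₀ x - g.est y x) ^ 2)) +
      ∫⁻ x, ENNReal.ofReal ((f₁ x - g.est y x) ^ 2) := by
  have hgy : Measurable (g.est y) := g.measurable_est.comp measurable_prodMk_left
  have hm : Measurable fun x => ENNReal.ofReal ((f₀ x - g.est y x) ^ 2) :=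
    ((h₀.sub hgy).pow_const 2).ennreal_ofReal
  rw [← lintegral_add_left hm]
  calc ENNReal.ofReal (D / 2) = ENNReal.ofReal (1 / 2) * ENNReal.ofReal D := by
        rw [← ENNReal.ofReal_mul (by norm_num)]; congr 1; ring
    _ ≤ ENNReal.ofReal (1 / 2) * ∫⁻ x, ENNReal.ofReal ((f₀ x - f₁ x) ^ 2) := by gcongr
    _ = ∫⁻ x, ENNReal.ofReal (1 / 2) * ENNReal.ofReal ((f₀ x - f₁ x) ^ 2) :=
        (lintegral_const_mul' _ _ ENNReal.ofReal_ne_top).symm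
    _ ≤ _ := by
        refine lintegral_mono fun x => ?_
        rw [← ENNReal.ofReal_mul (by norm_num), ← ENNReal.ofReal_add (sq_nonneg _) (sq_nonneg _)]
        refine ENNReal.ofReal_le_ofReal ?_
        -- This is `(p - q)² ≤ 2 (p² + q²)`, the source of the loss from `D` to `D / 2`.
        nlinarith [sq_nonneg (f₀ x - g.est y x + (f₁ x - g.est y x))]

/-- The minimax risk is bounded below by the separation of any two members of the class whose
aggregated laws are within a factor `1 ± e` of each other, with `n e²` bounded. -/
lemma le_minimaxRisk {K n : ℕ} {β b C C' CX Cf u₀ : ℝ} {f₀ f₁ : ℝ → ℝ}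
    (h₀ : InClass β b C C' CX Cf u₀ f₀) (h₁ : InClass β b C C' CX Cf u₀ f₁)
    {e M D : ℝ} (he0 : 0 ≤ e) (he1 : e ≤ 1)
    (hle : aggregatedLaw K f₁ ≤ aggregatedLaw K f₀ + ENNReal.ofReal e • aggregatedLaw K f₀)
    (hge : aggregatedLaw K f₀ ≤ aggregatedLaw K f₁ + ENNReal.ofReal e • aggregatedLaw K f₀)
    (hM : Real.exp (n * e ^ 2) ≤ M) (hD : 0 ≤ D)
    (hsep : ENNReal.ofReal D ≤ ∫⁻ x, ENNReal.ofReal ((f₀ x - f₁ x) ^ 2)) :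
    ENNReal.ofReal (3 * (D / 2) / (8 * (1 + M))) ≤ minimaxRisk K n β b C C' CX Cf u₀ := by
  refine le_iInf fun g => ?_
  have := isProbabilityMeasure_aggregatedLaw K h₀.density
  have := isProbabilityMeasure_aggregatedLaw K h₁.density
  refine two_point_bound he0 he1 hle hge hM (g.measurable_loss h₁.density.measurable)
    (by positivity) (g.loss_add_loss h₀.density.measurable hsep) ?_ ?_
  · exact le_iSup (fun f : {f : ℝ → ℝ // InClass β b C C' CX Cf u₀ f} => mise K n f.1 g) ⟨f₀, h₀⟩
  · exact le_iSup (fun f : {f : ℝ → ℝ // InClass β b C C' CX Cf u₀ f} => mise K n f.1 g) ⟨f₁, h₁⟩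

end GroupedData
end

open GroupedData

theorem theorem2 (β b : ℝ) (hβ : 1 < β) (hb : β ≤ b) :
    ∃ κ : ℝ, 0 < κ ∧ ∀ CX Cf : ℝ, 0 < CX → 0 < Cf → κ ≤ CX * Cf ^ 4 → ∀ u₀ : ℝ, 0 < u₀ →
      ∃ C₀ C₀' : ℝ, 0 < C₀ ∧ 0 < C₀' ∧
        ∀ C C' : ℝ, C₀ ≤ C → 0 < C' → C' ≤ C₀' → ∀ K : ℕ, 2 ≤ K →
          ∃ d : ℝ, 0 < d ∧
            ENNReal.ofReal d ≤
              Filter.liminf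
                (fun n : ℕ =>
                  GroupedData.minimaxRisk K n β b C C' CX Cf u₀ *
                    ENNReal.ofReal ((n : ℝ) ^ ((2 * β - 1) / (2 * b * (K : ℝ)))))
                Filter.atTop := by
  obtain ⟨δ, c, M, hδ, hc, hM, hP⟩ := exists_profile_spec hβ
  have hJ : 0 < ∫ x, x ^ 2 * tail x := by
    rw [integral_pos_iff_support_of_nonneg
      (fun x => mul_nonneg (sq_nonneg x) (tail_pos x).le) integrable_sq_mul_tail]
    have hsub : Set.Ioo (0 : ℝ) 1 ⊆ Function.support fun x => x ^ 2 * tail x := fun x hx =>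
      (mul_pos (pow_pos hx.1 2) (tail_pos x)).ne'
    exact lt_of_lt_of_le (by simp) (measure_mono hsub)
  have hI : 0 < ∫ x, tail x ^ 2 := by
    rw [integral_pos_iff_support_of_nonneg (fun x => sq_nonneg _) integrable_tail_sq]
    have hsub : Set.Ioo (0 : ℝ) 1 ⊆ Function.support fun x => tail x ^ 2 := fun x _ =>
      (pow_pos (tail_pos x) 2).ne'
    exact lt_of_lt_of_le (by simp) (measure_mono hsub)
  set B := M ^ 2 * ∫ x, tail x ^ 2 with hB
  have hB0 : 0 < B := by positivity
  -- The `L²` bound asks for `t ≥ B / Cf²`, the second moment for `t² M ∫ x² tail ≤ CX`. The least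
  -- admissible `t` meets the latter exactly when `CX * Cf⁴` is at least this `κ`.
  refine ⟨B ^ 2 * (M * ∫ x, x ^ 2 * tail x), by positivity, fun CX Cf hCX hCf hκ u₀ hu₀ => ?_⟩
  set t := B / Cf ^ 2 with ht
  have ht0 : 0 < t := by positivity
  obtain ⟨C₀, C₀', hC₀, hC₀', hclass⟩ := exists_inClass (CX := CX) (Cf := Cf) hβ hb hδ hc hM ht0 hu₀
    hP (by
      rw [ht, div_pow, div_mul_eq_mul_div, div_le_iff₀ (by positivity)]
      calc _ ≤ CX * Cf ^ 4 := hκ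
        _ = _ := by ring) hCf.le (by rw [ht, ← hB]; field_simp; rfl)
  refine ⟨C₀, C₀', hC₀, hC₀', fun C C' hC hC'0 hC' K hK => ?_⟩
  have hK0 : K ≠ 0 := by omega
  have hKr : (2 : ℝ) ≤ K := by exact_mod_cast hK
  have hb0 : 0 < b := by linarith
  set θ := 2 * Real.pi / K with hθ
  have hθ0 : 0 < θ := by positivity
  -- Here `K ≥ 2` enters: the twist is then a genuine rotation, `exp (iθ) ≠ 1`.
  have hθπ : θ ≤ Real.pi := by
    rw [hθ, div_le_iff₀ (by positivity)]; nlinarith [Real.pi_pos]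
  obtain ⟨A, hA, hclose⟩ := exists_aggregatedLaw_close (t := t) hβ hδ hc ht0 hP hK0
  obtain ⟨q, hq, hsep⟩ := exists_separation (t := t) hβ hδ hc ht0 hθ0 hθπ hP
  set E := Real.exp (A ^ 2) with hE
  have hE0 : 0 < E := Real.exp_pos _
  refine ⟨3 * (q / 2) / (8 * (1 + E)), by positivity, ?_⟩
  refine le_liminf_of_le (by isBoundedDefault) ?_
  have hexp : 0 < 1 / (2 * b * (K : ℝ)) := by positivity
  have htend : Tendsto (fun n : ℕ => (n : ℝ) ^ (1 / (2 * b * (K : ℝ)))) atTop atTop :=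
    (tendsto_rpow_atTop hexp).comp tendsto_natCast_atTop_atTop
  filter_upwards [htend.eventually_ge_atTop 4, eventually_ge_atTop 1,
    tendsto_natCast_atTop_atTop.eventually_ge_atTop (A ^ 2)] with n hm hn1 hnA
  set m := (n : ℝ) ^ (1 / (2 * b * (K : ℝ))) with hmdef
  have hn0 : (0 : ℝ) < n := by exact_mod_cast hn1
  have hm0 : 0 < m := by linarith
  set ε := m ^ (-(b - β)) with hε
  have hε0 : 0 ≤ ε := Real.rpow_nonneg hm0.le _
  have hε1 : ε ≤ 1 := Real.rpow_le_one_of_one_le_of_nonpos (by linarith) (by linarith)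
  -- The choice of `m` is made for this: `ε m ^ (-β) = m ^ (-b)` and `m ^ (2bK) = n`, so `n e² = A²`
  -- stays bounded.
  have hsmall : ((ε * m ^ (-β)) ^ K) ^ 2 = (n : ℝ)⁻¹ := by
    rw [hε, ← Real.rpow_add hm0, show -(b - β) + -β = -b by ring, hmdef, ← pow_mul,
      ← Real.rpow_mul hn0.le, ← Real.rpow_natCast, ← Real.rpow_mul hn0.le, ← Real.rpow_neg_one]
    congr 1
    push_cast
    field_simp
  set e := A * (ε * m ^ (-β)) ^ K with he
  have he2 : e ^ 2 = A ^ 2 * (n : ℝ)⁻¹ := by rw [he, mul_pow, hsmall]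
  have he0 : 0 ≤ e :=
    mul_nonneg hA (pow_nonneg (mul_nonneg hε0 (Real.rpow_nonneg hm0.le _)) _)
  have he1 : e ≤ 1 := by
    rw [← abs_of_nonneg he0, ← sq_le_one_iff_abs_le_one, he2, ← div_eq_mul_inv,
      div_le_one hn0]
    exact hnA
  have hθ' : |θ| ≤ 2 * Real.pi := by rw [abs_of_pos hθ0]; linarith [Real.pi_pos]
  have hbound := le_minimaxRisk (K := K) (n := n)
    (hclass C C' hC hC'0 hC' m 0 hm (by rw [abs_zero]; positivity))
    (hclass C C' hC hC'0 hC' m θ hm hθ') he0 he1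
    (hclose m ε hm hε0 hε1).1 (hclose m ε hm hε0 hε1).2 (M := E)
    (by rw [he2, hE, mul_comm, mul_assoc, inv_mul_cancel₀ hn0.ne', mul_one])
    (D := q * m ^ (1 - 2 * β)) (by positivity) (hsep m ε hm hε0 hε1)
  refine le_trans (le_of_eq ?_) (mul_le_mul_left hbound _)
  rw [← ENNReal.ofReal_mul (by positivity)]
  congr 1
  -- The separation `m ^ (1 - 2β)` is the inverse of the normalizing factor, so the lower bound is
  -- the constant `d` for every large `n`.
  have hrate : m ^ (1 - 2 * β) * (n : ℝ) ^ ((2 * β - 1) / (2 * b * (K : ℝ))) = 1 := by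
    rw [hmdef, ← Real.rpow_mul hn0.le, ← Real.rpow_add hn0]
    rw [show 1 / (2 * b * (K : ℝ)) * (1 - 2 * β) + (2 * β - 1) / (2 * b * (K : ℝ)) = 0 by ring,
      Real.rpow_zero]
  calc 3 * (q / 2) / (8 * (1 + E)) = 3 * (q / 2) / (8 * (1 + E)) *
        (m ^ (1 - 2 * β) * (n : ℝ) ^ ((2 * β - 1) / (2 * b * (K : ℝ)))) := by
          rw [hrate, mul_one]
    _ = _ := by ring
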